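/- A polygon with $k$ vertices is stored in read-only memory as the list of its vertices in circular order (starting at an arbitrary vertex, in either direction). An algorithm has, besides the input, a number of words of work-space, each of which holds either a pointer to an input vertex or a coordinate of an input vertex. In one step it can copy a pointer, move a pointer to the next or the previous vertex of the polygon, load the $x$- or $y$-coordinate of a vertex that a pointer points to, perform an elementary operation of a test (compare two pointers for equality, compare two coordinates, decide whether a vertex lies strictly to the left of the directed line through two other vertices, negation, conjunction), or output a triangle given by three pointers; outputs cannot be read back. Control is by sequencing, branching and while-loops. A *mountain* is a simple polygon whose vertices can be labelled $a_1,\dots,a_k$ in circular order such that the $x$-coordinates of $a_1,\dots,a_k$ are increasing. **Statement.** There are one algorithm in this model, with a number of words of work-space that is a constant independent of the input, and a constant $C$ such that the following holds for every $k$ and every mountain $H$ with $k$ vertices in general position (no three vertices on a line and no two vertices with the same $x$-coordinate): given $H$, and whatever the initial contents of the work-space, the algorithm halts after at most $C k^2$ steps, and it outputs all the triangles of a triangulation of $H$, each exactly once. Here a triangulation of $H$ is a set of nondegenerate triangles with vertices among those of $H$ whose union is the closed region bounded by $H$, such that any two of them intersect exactly in the convex hull of their common vertices. -/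

import Mathlib

/-! ### Simple polygons, mountains and triangulations in the Euclidean plane -/

/-- The Euclidean plane; the coordinates of `q` are `q 0` and `q 1`. -/
abbrev Plane : Type := EuclideanSpace ℝ (Fin 2)

/-- `H` is a simple polygon: it has at least three vertices, the vertices are distinct, and two
different edges meet exactly in the vertices they share (`finRotate k` is the cyclic successor
on `Fin k`, and the `i`-th edge joins the vertices `i` and `finRotate k i`). -/
structure IsSimplePolygon {k : ℕ} (H : Polygon Plane k) : Prop where
  three_le : 3 ≤ k
  vertices_injective : Function.Injective H.vertices
  edge_inter : ∀ i j : Fin k, i ≠ j →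
    H.edgeSet ℝ i ∩ H.edgeSet ℝ j = H.vertices '' ({i, finRotate k i} ∩ {j, finRotate k j})

/-- The closed region of a polygon: its boundary curve together with the bounded connected
components of the complement of that curve. -/
def polygonRegion {k : ℕ} (H : Polygon Plane k) : Set Plane :=
  H.boundary ℝ ∪
    {q | q ∉ H.boundary ℝ ∧ Bornology.IsBounded (connectedComponentIn (H.boundary ℝ)ᶜ q)}

/-- General position: no three vertices on a line, no two vertices with the same
`x`-coordinate. -/
structure InGeneralPosition {k : ℕ} (H : Polygon Plane k) : Prop where
  not_collinear : ∀ i j l : Fin k, i ≠ j → i ≠ l → j ≠ l → ¬ Collinear ℝ {H i, H j, H l}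
  x_injective : Function.Injective fun i => H i 0

/-- `H` is a (monotone) mountain: it is a simple polygon whose vertices, listed in circular order
in one of the two directions and from a suitable first vertex on, have increasing
`x`-coordinates. (Addition and subtraction on `Fin k` are modulo `k`.) -/
def IsMountain {k : ℕ} (H : Polygon Plane k) : Prop :=
  IsSimplePolygon H ∧
    ∃ r : Fin k, StrictMono (fun i : Fin k => H (r + i) 0) ∨
      StrictMono (fun i : Fin k => H (r - i) 0)

/-- The closed set spanned by a set of vertices of `H`. -/
def vertexHull {k : ℕ} (H : Polygon Plane k) (t : Finset (Fin k)) : Set Plane :=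
  convexHull ℝ (H.vertices '' (t : Set (Fin k)))

/-- `T` is (the set of triangles of) a triangulation of the polygon `H`, each triangle being given
by its set of vertices: the members of `T` are nondegenerate triangles spanned by vertices of `H`,
they cover exactly the closed region of `H`, and any two of them meet exactly in the common
vertex, the common side, or not at all, according to the vertices they share. -/
structure IsTriangulation {k : ℕ} (H : Polygon Plane k) (T : Set (Finset (Fin k))) : Prop where
  card_eq : ∀ t ∈ T, t.card = 3
  nondegenerate : ∀ t ∈ T, AffineIndependent ℝ (fun i : t => H i)
  cover : ⋃ t ∈ T, vertexHull H t = polygonRegion H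
  inter : ∀ t ∈ T, ∀ t' ∈ T, vertexHull H t ∩ vertexHull H t' = vertexHull H (t ∩ t')

/-! ### Programs with constant work-space

The input is a polygon in read-only memory. The work-space consists of `m` words that hold pointers
to input vertices and `n` words that hold coordinates of input vertices. A program moves pointers
along the polygon, loads coordinates, compares, and outputs triangles; the output cannot be read
back. There is no arithmetic on words, so that a word never holds anything but a pointer or an
input item. -/

/-- The contents of the work-space. -/
structure WorkSpace (k m n : ℕ) where
  ptr : Fin m → Fin k
  coord : Fin n → ℝ

/-- Tests of a program with `m` pointer words and `n` coordinate words. -/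
inductive Test (m n : ℕ) : Type
  /-- do two pointers point to the same vertex? -/
  | samePtr (p q : Fin m) : Test m n
  /-- is the first coordinate word smaller than the second one? -/
  | coordLT (c d : Fin n) : Test m n
  /-- does the third vertex lie strictly to the left of the directed line from the first vertex
  to the second one? -/
  | leftOf (p q r : Fin m) : Test m n
  | not (b : Test m n) : Test m n
  | and (b b' : Test m n) : Test m n

/-- `b.Holds H s`: the test `b` is passed on the input `H` with the work-space `s`. -/
def Test.Holds {k m n : ℕ} (H : Polygon Plane k) (s : WorkSpace k m n) : Test m n → Prop
  | samePtr p q => s.ptr p = s.ptr q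
  | coordLT c d => s.coord c < s.coord d
  | leftOf p q r =>
      0 < (H (s.ptr q) 0 - H (s.ptr p) 0) * (H (s.ptr r) 1 - H (s.ptr p) 1)
        - (H (s.ptr q) 1 - H (s.ptr p) 1) * (H (s.ptr r) 0 - H (s.ptr p) 0)
  | not b => ¬ b.Holds H s
  | and b b' => b.Holds H s ∧ b'.Holds H s

/-- The time for a test: one step for each symbol in it. -/
def Test.cost {m n : ℕ} : Test m n → ℕ
  | samePtr _ _ => 1
  | coordLT _ _ => 1
  | leftOf _ _ _ => 1
  | not b => b.cost + 1
  | and b b' => b.cost + b'.cost + 1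

/-- Programs with `m` pointer words and `n` coordinate words. -/
inductive Program (m n : ℕ) : Type
  | skip : Program m n
  /-- copy the pointer `q` to `p` -/
  | copy (p q : Fin m) : Program m n
  /-- advance the pointer `p` to the next vertex of the polygon in the stored circular order -/
  | next (p : Fin m) : Program m n
  /-- move the pointer `p` back to the previous vertex of the polygon -/
  | prev (p : Fin m) : Program m n
  /-- load the `x`-coordinate of the vertex that `p` points to into the coordinate word `c` -/
  | loadX (c : Fin n) (p : Fin m) : Program m n
  /-- load the `y`-coordinate of the vertex that `p` points to into the coordinate word `c` -/
  | loadY (c : Fin n) (p : Fin m) : Program m n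
  /-- output the triangle given by three pointers -/
  | output (p q r : Fin m) : Program m n
  | seq (S S' : Program m n) : Program m n
  | ite (b : Test m n) (S S' : Program m n) : Program m n
  | while (b : Test m n) (S : Program m n) : Program m n

/-- `Runs H S s t out s'`: on the input `H`, the program `S`, started with the work-space `s`, halts
after exactly `t` steps with the work-space `s'`, and `out` is the list of its outputs, in order. -/
inductive Runs {k m n : ℕ} (H : Polygon Plane k) :
    Program m n → WorkSpace k m n → ℕ → List (Fin k × Fin k × Fin k) → WorkSpace k m n → Prop
  | skip (s : WorkSpace k m n) : Runs H .skip s 1 [] s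
  | copy (p q : Fin m) (s : WorkSpace k m n) :
      Runs H (.copy p q) s 1 [] ⟨Function.update s.ptr p (s.ptr q), s.coord⟩
  | next (p : Fin m) (s : WorkSpace k m n) :
      Runs H (.next p) s 1 [] ⟨Function.update s.ptr p (finRotate k (s.ptr p)), s.coord⟩
  | prev (p : Fin m) (s : WorkSpace k m n) :
      Runs H (.prev p) s 1 [] ⟨Function.update s.ptr p ((finRotate k).symm (s.ptr p)), s.coord⟩
  | loadX (c : Fin n) (p : Fin m) (s : WorkSpace k m n) :
      Runs H (.loadX c p) s 1 [] ⟨s.ptr, Function.update s.coord c (H (s.ptr p) 0)⟩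
  | loadY (c : Fin n) (p : Fin m) (s : WorkSpace k m n) :
      Runs H (.loadY c p) s 1 [] ⟨s.ptr, Function.update s.coord c (H (s.ptr p) 1)⟩
  | output (p q r : Fin m) (s : WorkSpace k m n) :
      Runs H (.output p q r) s 1 [(s.ptr p, s.ptr q, s.ptr r)] s
  | seq {S S' : Program m n} {s s' s'' : WorkSpace k m n} {t t' : ℕ}
      {out out' : List (Fin k × Fin k × Fin k)} :
      Runs H S s t out s' → Runs H S' s' t' out' s'' →
      Runs H (.seq S S') s (t + t') (out ++ out') s''
  | ite_true {b : Test m n} {S S' : Program m n} {s s' : WorkSpace k m n} {t : ℕ}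
      {out : List (Fin k × Fin k × Fin k)} :
      b.Holds H s → Runs H S s t out s' → Runs H (.ite b S S') s (b.cost + t) out s'
  | ite_false {b : Test m n} {S S' : Program m n} {s s' : WorkSpace k m n} {t : ℕ}
      {out : List (Fin k × Fin k × Fin k)} :
      ¬ b.Holds H s → Runs H S' s t out s' → Runs H (.ite b S S') s (b.cost + t) out s'
  | while_false {b : Test m n} {S : Program m n} {s : WorkSpace k m n} :
      ¬ b.Holds H s → Runs H (.while b S) s b.cost [] s
  | while_true {b : Test m n} {S : Program m n} {s s' s'' : WorkSpace k m n} {t t' : ℕ}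
      {out out' : List (Fin k × Fin k × Fin k)} :
      b.Holds H s → Runs H S s t out s' → Runs H (.while b S) s' t' out' s'' →
      Runs H (.while b S) s (b.cost + t + t') (out ++ out') s''

/-- The outputs of a run as sets of vertices, in the order in which they are produced. -/
def outputTriangles {k : ℕ} (out : List (Fin k × Fin k × Fin k)) : List (Finset (Fin k)) :=
  out.map fun a => {a.1, a.2.1, a.2.2}

/-- The output is a triangulation of `H`, and every triangle is output exactly once. -/
def OutputsTriangulation {k : ℕ} (H : Polygon Plane k)
    (out : List (Fin k × Fin k × Fin k)) : Prop :=
  (outputTriangles out).Nodup ∧ IsTriangulation H {t | t ∈ outputTriangles out}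

/-!
The vertices of a mountain, listed by increasing abscissas, are `a 0, …, a n`, and up to a
reflection the chain `a 1, …, a (n - 1)` lies above the segment from `a 0` to `a n`, the base.
Every `a j` with `0 < j < n` is the middle vertex of exactly one triangle of the output: its
left vertex is the vertex before `a j` from which the slope to `a j` is largest (`IsLeft`), and its
right vertex is the first vertex after `a j` below the line through these two (`IsRight`). Both are
found by a linear scan with a constant number of pointers. As nothing has to be remembered from one
triangle to the next, the whole work is a loop over `j`, and it takes quadratic time.

That the triangles fit together is seen recursively. Call `(i, l)` a base (`IsBase`) if the vertices
strictly between lie above the segment from `a i` to `a l` and their triangles do not reach to the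
left of `a i`. The vertex `a j` in which the slope from `a i` is smallest then has exactly the
triangle `i, j, l`, and `(i, j)` and `(j, l)` are again bases (`IsBase.exists_apex`). By induction
over the bases, the triangles fill the region between base and chain (`IsBase.chainRegion_eq`), and
two of them meet in the hull of their common vertices because they are separated by a side of a
triangle or by a vertical line (`IsBase.inter_subset`). The region between base and chain is the
closed region of the polygon (`IsTerrain.region_eq`): a point outside it sees infinity along a
vertical ray, and the curve separates the points inside from the rest of the plane.

The stored list may run in either direction and the chain may lie on either side of its base. The
program determines both, after it has found the leftmost vertex as the only one that is to the left
of both its neighbours, and branches into one of four copies of the loop.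
-/

/-! ### Orientation and convexity -/

/-- Twice the signed area of the triangle `p q r`, multiplied by a sign `σ`. With `σ = 1` the value
is positive when `r` lies to the left of the directed line from `p` to `q`; the sign `σ = -1`
reflects the plane in the `x`-axis. For `p 0 < q 0`, "above the line `p q`" means that
`orient σ p q` is positive. -/
def orient (σ : ℝ) (p q r : Plane) : ℝ :=
  σ * ((q 0 - p 0) * (r 1 - p 1) - (q 1 - p 1) * (r 0 - p 0))

section Orient

variable (σ : ℝ) (p q r s : Plane)

lemma orient_swap : orient σ p r q = -orient σ p q r := by
  unfold orient; ring

lemma orient_rotate : orient σ q r p = orient σ p q r := by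
  unfold orient; ring

lemma orient_self_left : orient σ p q p = 0 := by
  unfold orient; ring

lemma orient_self_right : orient σ p q q = 0 := by
  unfold orient; ring

/-- The linear relation between the abscissas of three points as seen from a pivot `p`. It is the
source of all transitivity properties of "above" and "below" that are needed. -/
lemma orient_pivot :
    orient σ p q r * (s 0 - p 0) + orient σ p r s * (q 0 - p 0) + orient σ p s q * (r 0 - p 0)
      = 0 := by
  unfold orient; ring

/-- A function on the plane that respects affine combinations of two points. -/
def IsAffineFun (φ : Plane → ℝ) : Prop :=
  ∀ (x y : Plane) (a b : ℝ), a + b = 1 → φ (a • x + b • y) = a * φ x + b * φ y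

lemma isAffineFun_orient : IsAffineFun (orient σ p q) := by
  intro x y a b hab
  obtain rfl : b = 1 - a := by linarith
  simp only [orient, PiLp.add_apply, PiLp.smul_apply, smul_eq_mul]
  ring

lemma isAffineFun_abscissa (c : ℝ) : IsAffineFun fun x => x 0 - c := by
  intro x y a b hab
  obtain rfl : b = 1 - a := by linarith
  simp only [PiLp.add_apply, PiLp.smul_apply, smul_eq_mul]
  ring

variable {σ p q r s}

lemma IsAffineFun.neg {φ : Plane → ℝ} (hφ : IsAffineFun φ) : IsAffineFun fun x => -φ x := by
  intro x y a b hab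
  simp only [hφ x y a b hab]
  ring

lemma IsAffineFun.convex_nonneg {φ : Plane → ℝ} (hφ : IsAffineFun φ) :
    Convex ℝ {x | 0 ≤ φ x} := by
  intro x hx y hy a b ha hb hab
  simp only [Set.mem_ofPred_eq] at hx hy ⊢
  rw [hφ x y a b hab]
  positivity

lemma IsAffineFun.nonneg_of_mem_convexHull {φ : Plane → ℝ} (hφ : IsAffineFun φ) {S : Set Plane}
    (hS : ∀ x ∈ S, 0 ≤ φ x) {x : Plane} (hx : x ∈ convexHull ℝ S) : 0 ≤ φ x :=
  convexHull_min (t := {x | 0 ≤ φ x}) hS hφ.convex_nonneg hx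

lemma IsAffineFun.nonpos_of_mem_convexHull {φ : Plane → ℝ} (hφ : IsAffineFun φ) {S : Set Plane}
    (hS : ∀ x ∈ S, φ x ≤ 0) {x : Plane} (hx : x ∈ convexHull ℝ S) : φ x ≤ 0 := by
  have := hφ.neg.nonneg_of_mem_convexHull (S := S) (fun x hx => by simpa using hS x hx) hx
  linarith

/-- The points of a convex hull on a supporting line lie in the hull of the generators on that
line. -/
lemma IsAffineFun.mem_convexHull_zero {φ : Plane → ℝ} (hφ : IsAffineFun φ) {S : Set Plane}
    (hS : ∀ x ∈ S, 0 ≤ φ x) {x : Plane} (hx : x ∈ convexHull ℝ S) (h0 : φ x = 0) :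
    x ∈ convexHull ℝ {y ∈ S | φ y = 0} := by
  set C : Set Plane := {z | 0 ≤ φ z ∧ (φ z = 0 → z ∈ convexHull ℝ {y ∈ S | φ y = 0})} with hC
  have hconv : Convex ℝ C := by
    intro y hy z hz a b ha hb hab
    have he := hφ y z a b hab
    have h1 := mul_nonneg ha hy.1
    have h2 := mul_nonneg hb hz.1
    refine ⟨by rw [he]; positivity, fun h => ?_⟩
    rcases ha.eq_or_lt with rfl | ha'
    · obtain rfl : b = 1 := by linarith
      simp only [zero_smul, one_smul, zero_add] at h ⊢
      exact hz.2 h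
    rcases hb.eq_or_lt with rfl | hb'
    · obtain rfl : a = 1 := by linarith
      simp only [zero_smul, one_smul, add_zero] at h ⊢
      exact hy.2 h
    have hy0 : φ y = 0 := by
      have : a * φ y = 0 := by linarith
      rcases mul_eq_zero.1 this with h | h
      · exact absurd h ha'.ne'
      · exact h
    have hz0 : φ z = 0 := by
      have : b * φ z = 0 := by linarith
      rcases mul_eq_zero.1 this with h | h
      · exact absurd h hb'.ne'
      · exact h
    exact convex_convexHull ℝ _ (hy.2 hy0) (hz.2 hz0) ha hb hab
  have hsub : S ⊆ C := fun y hy => ⟨hS y hy, fun h => subset_convexHull ℝ _ ⟨hy, h⟩⟩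
  exact (convexHull_min hsub hconv hx).2 h0

/-- Two hulls separated by a line meet only in the hulls of the generators on that line. -/
lemma IsAffineFun.mem_convexHull_of_separated {φ : Plane → ℝ} (hφ : IsAffineFun φ)
    {v : ℕ → Plane} {t t' : Finset ℕ} (ht : ∀ m ∈ t, 0 ≤ φ (v m)) (ht' : ∀ m ∈ t', φ (v m) ≤ 0)
    {x : Plane} (hx : x ∈ convexHull ℝ (v '' t)) (hx' : x ∈ convexHull ℝ (v '' t')) :
    x ∈ convexHull ℝ (v '' {m | m ∈ t ∧ φ (v m) = 0}) ∧
      x ∈ convexHull ℝ (v '' {m | m ∈ t' ∧ φ (v m) = 0}) := by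
  have h1 : ∀ y ∈ v '' t, 0 ≤ φ y := by rintro _ ⟨m, hm, rfl⟩; exact ht m hm
  have h2 : ∀ y ∈ v '' t', φ y ≤ 0 := by rintro _ ⟨m, hm, rfl⟩; exact ht' m hm
  have h0 : φ x = 0 :=
    le_antisymm (hφ.nonpos_of_mem_convexHull h2 hx') (hφ.nonneg_of_mem_convexHull h1 hx)
  refine ⟨convexHull_mono ?_ (hφ.mem_convexHull_zero h1 hx h0),
    convexHull_mono ?_ (hφ.neg.mem_convexHull_zero
      (fun y hy => by simpa using h2 y hy) hx' (by simpa using h0))⟩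
  · rintro _ ⟨⟨m, hm, rfl⟩, h⟩
    exact ⟨m, ⟨hm, h⟩, rfl⟩
  · rintro _ ⟨⟨m, hm, rfl⟩, h⟩
    exact ⟨m, ⟨hm, by simpa using h⟩, rfl⟩

lemma mem_segment_iff_orient (hσ : σ * σ = 1) (hpr : p 0 < r 0) :
    q ∈ segment ℝ p r ↔ p 0 ≤ q 0 ∧ q 0 ≤ r 0 ∧ orient σ p r q = 0 := by
  constructor
  · rintro ⟨a, b, ha, hb, hab, rfl⟩
    refine ⟨?_, ?_, ?_⟩
    · simp only [PiLp.add_apply, PiLp.smul_apply, smul_eq_mul]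
      obtain rfl : a = 1 - b := by linarith
      nlinarith
    · simp only [PiLp.add_apply, PiLp.smul_apply, smul_eq_mul]
      obtain rfl : b = 1 - a := by linarith
      nlinarith
    · rw [isAffineFun_orient σ p r p r a b hab, orient_self_left, orient_self_right]
      ring
  · rintro ⟨h1, h2, h3⟩
    have hd : 0 < r 0 - p 0 := by linarith
    have h4 : (r 0 - p 0) * (q 1 - p 1) - (r 1 - p 1) * (q 0 - p 0) = 0 := by
      rcases mul_eq_zero.1 h3 with h | h
      · simp [h] at hσ
      · exact h
    refine ⟨(r 0 - q 0) / (r 0 - p 0), (q 0 - p 0) / (r 0 - p 0), div_nonneg (by linarith) hd.le,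
      div_nonneg (by linarith) hd.le, by field_simp; ring, ?_⟩
    ext k
    fin_cases k
    · simp only [Fin.zero_eta, PiLp.add_apply, PiLp.smul_apply, smul_eq_mul]
      field_simp
      ring
    · simp only [Fin.mk_one, PiLp.add_apply, PiLp.smul_apply, smul_eq_mul]
      field_simp
      linarith

/-- A triangle whose middle vertex lies above its long side is an intersection of half planes. -/
lemma mem_convexHull_triangle_iff (h : orient σ p q r < 0) :
    s ∈ convexHull ℝ {p, q, r} ↔
      0 ≤ orient σ p r s ∧ orient σ p q s ≤ 0 ∧ orient σ q r s ≤ 0 := by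
  have e1 : orient σ p r q = -orient σ p q r := orient_swap ..
  have e2 : orient σ q r p = orient σ p q r := orient_rotate ..
  constructor
  · intro hs
    refine ⟨(isAffineFun_orient σ p r).nonneg_of_mem_convexHull ?_ hs,
      (isAffineFun_orient σ p q).nonpos_of_mem_convexHull ?_ hs,
      (isAffineFun_orient σ q r).nonpos_of_mem_convexHull ?_ hs⟩ <;>
    · rintro x (rfl | rfl | rfl) <;>
      first | rw [orient_self_left] | rw [orient_self_right] | linarith
  · rintro ⟨h1, h2, h3⟩
    set D := orient σ p q r with hD
    have key : ∀ k : Fin 2, k = 0 ∨ k = 1 → s k =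
        orient σ q r s / D * p k + -orient σ p r s / D * q k + orient σ p q s / D * r k := by
      intro k hk
      have e : orient σ q r s * p k - orient σ p r s * q k + orient σ p q s * r k = D * s k := by
        rcases hk with rfl | rfl <;> simp only [hD, orient] <;> ring
      have e' : orient σ q r s / D * p k + -orient σ p r s / D * q k + orient σ p q s / D * r k =
          (orient σ q r s * p k - orient σ p r s * q k + orient σ p q s * r k) / D := by ring
      rw [e', e, mul_div_cancel_left₀ _ h.ne]
    have hs : s = ∑ k : Fin 3, (![orient σ q r s / D, -orient σ p r s / D, orient σ p q s / D] k) •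
        (![p, q, r] k) := by
      simp only [Fin.sum_univ_three, Matrix.cons_val]
      ext k
      fin_cases k
      · exact key 0 (Or.inl rfl)
      · exact key 1 (Or.inr rfl)
    rw [hs]
    refine (convex_convexHull ℝ _).sum_mem ?_ ?_ ?_
    · intro k _
      fin_cases k
      · exact div_nonneg_of_nonpos h3 h.le
      · exact div_nonneg_of_nonpos (by linarith) h.le
      · exact div_nonneg_of_nonpos h2 h.le
    · simp only [Fin.sum_univ_three, Matrix.cons_val]
      rw [← add_div, ← add_div, div_eq_one_iff_eq h.ne]
      simp only [hD, orient]
      ring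
    · intro k _
      apply subset_convexHull
      fin_cases k <;> simp

end Orient

/-! ### The triangles of a mountain -/

/-- The points `v 0, …, v n` have increasing abscissas, no three of them are on a line, and
`v 1, …, v (n - 1)` lie above the segment from `v 0` to `v n` (below it, if `σ = -1`). -/
structure IsTerrain (σ : ℝ) (v : ℕ → Plane) (n : ℕ) : Prop where
  sign : σ * σ = 1
  pos : 0 < n
  lt : ∀ i j, i < j → j ≤ n → v i 0 < v j 0
  ne : ∀ i j l, i < j → j < l → l ≤ n → orient σ (v i) (v j) (v l) ≠ 0
  base : ∀ j, 0 < j → j < n → 0 < orient σ (v 0) (v n) (v j)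

/-- Among the points before `v j`, the point `v i` is the one from which the slope to `v j` is
largest. -/
def IsLeft (σ : ℝ) (v : ℕ → Plane) (j i : ℕ) : Prop :=
  i < j ∧ ∀ m < j, 0 ≤ orient σ (v i) (v j) (v m)

/-- The point `v l` is the first one after `v j` below the line through `v i` and `v j`. -/
def IsRight (σ : ℝ) (v : ℕ → Plane) (i j l : ℕ) : Prop :=
  j < l ∧ orient σ (v i) (v j) (v l) < 0 ∧
    ∀ m, j < m → m < l → 0 ≤ orient σ (v i) (v j) (v m)

/-- `L` and `R` choose a left and a right vertex for every `j` strictly between `0` and `n`; the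
triangle of `v j` has the vertices `v (L j)`, `v j` and `v (R j)`. -/
structure IsFan (σ : ℝ) (v : ℕ → Plane) (n : ℕ) (L R : ℕ → ℕ) : Prop where
  left : ∀ j, 0 < j → j < n → IsLeft σ v j (L j)
  right : ∀ j, 0 < j → j < n → IsRight σ v (L j) j (R j)
  le : ∀ j, 0 < j → j < n → R j ≤ n

/-- The points strictly between `v i` and `v l` lie above the segment from `v i` to `v l`, and their
triangles do not reach to the left of `v i`. -/
structure IsBase (σ : ℝ) (v : ℕ → Plane) (n : ℕ) (L : ℕ → ℕ) (i l : ℕ) : Prop where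
  lt : i < l
  le : l ≤ n
  above : ∀ j, i < j → j < l → 0 < orient σ (v i) (v l) (v j)
  left : ∀ j, i < j → j < l → i ≤ L j

section Chain

variable {σ : ℝ} {v : ℕ → Plane} {n : ℕ} {L R : ℕ → ℕ} {i j l : ℕ}

lemma IsTerrain.isBase (hv : IsTerrain σ v n) : IsBase σ v n L 0 n :=
  ⟨hv.pos, le_rfl, hv.base, fun _ _ _ => Nat.zero_le _⟩

lemma IsTerrain.le (hv : IsTerrain σ v n) (hij : i ≤ j) (hj : j ≤ n) : v i 0 ≤ v j 0 := by
  rcases hij.eq_or_lt with rfl | h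
  · exact le_rfl
  · exact (hv.lt i j h hj).le

lemma IsTerrain.index_eq (hv : IsTerrain σ v n) (hi : i ≤ n) (hj : j ≤ n) (h : v i 0 = v j 0) :
    i = j := by
  rcases lt_trichotomy i j with h' | h' | h'
  · exact absurd h (hv.lt i j h' hj).ne
  · exact h'
  · exact absurd h (hv.lt j i h' hi).ne'

/-- The lowest direction from `v i` into the chain. -/
lemma IsTerrain.exists_min_slope (hv : IsTerrain σ v n) (hil : i + 1 < l) (hl : l ≤ n) :
    ∃ j, i < j ∧ j < l ∧ ∀ m, i < m → m < l → 0 ≤ orient σ (v i) (v j) (v m) := by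
  obtain ⟨j, hj, hmin⟩ := Finset.exists_min_image (Finset.Ioo i l)
    (fun m => σ * (v m 1 - v i 1) / (v m 0 - v i 0)) ⟨i + 1, by simp [hil]⟩
  rw [Finset.mem_Ioo] at hj
  refine ⟨j, hj.1, hj.2, fun m h1 h2 => ?_⟩
  have h := hmin m (Finset.mem_Ioo.2 ⟨h1, h2⟩)
  have hj0 := hv.lt i j hj.1 (by omega)
  have hm0 := hv.lt i m h1 (by omega)
  rw [div_le_div_iff₀ (by linarith) (by linarith)] at h
  unfold orient
  linarith

/-- Every base with points above it is the long side of a triangle, whose other sides are bases. -/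
lemma IsBase.exists_apex (hv : IsTerrain σ v n) (hf : IsFan σ v n L R) (hb : IsBase σ v n L i l)
    (hil : i + 1 < l) :
    ∃ j, i < j ∧ j < l ∧ L j = i ∧ R j = l ∧ IsBase σ v n L i j ∧ IsBase σ v n L j l := by
  have hln := hb.le
  obtain ⟨j, hij, hjl, hmin⟩ := hv.exists_min_slope hil hln
  have hpos : ∀ m, i < m → m < l → m ≠ j → 0 < orient σ (v i) (v j) (v m) := by
    intro m h1 h2 h3
    refine lt_of_le_of_ne (hmin m h1 h2) (Ne.symm ?_)
    rcases lt_or_gt_of_ne h3 with h | h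
    · rw [orient_swap]
      exact neg_ne_zero.2 (hv.ne i m j h1 h (by omega))
    · exact hv.ne i j m hij h (by omega)
  have hneg : orient σ (v i) (v j) (v l) < 0 := by
    have := hb.above j hij hjl
    rw [orient_swap] at this
    linarith
  have hL : L j = i := by
    refine le_antisymm (not_lt.1 fun h => ?_) (hb.left j hij hjl)
    obtain ⟨h1, h2⟩ := hf.left j (by omega) (by omega)
    have h3 := h2 i hij
    have h4 := hpos (L j) h (by omega) (by omega)
    rw [orient_rotate, orient_swap] at h3
    linarith
  have hR : R j = l := by
    obtain ⟨h1, h2, h3⟩ := hf.right j (by omega) (by omega)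
    rw [hL] at h2 h3
    rcases lt_trichotomy (R j) l with h | h | h
    · exact absurd h2 (not_lt.2 (hmin _ (by omega) h))
    · exact h
    · exact absurd hneg (not_lt.2 (h3 l hjl h))
  have xij := hv.lt i j hij (by omega)
  have xjl := hv.lt j l hjl (by omega)
  refine ⟨j, hij, hjl, hL, hR, ⟨hij, by omega, fun m h1 h2 => hpos m h1 (by omega) (by omega),
    fun m h1 h2 => hb.left m h1 (by omega)⟩, ⟨hjl, hln, fun m h1 h2 => ?_, fun m h1 h2 => ?_⟩⟩
  · have xjm := hv.lt j m h1 (by omega)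
    have e := orient_pivot σ (v j) (v i) (v m) (v l)
    have hm := hpos m (by omega) h2 (by omega)
    have e1 : orient σ (v j) (v i) (v m) = -orient σ (v i) (v j) (v m) := by
      unfold orient; ring
    rw [e1, orient_swap σ (v j) (v l) (v m), orient_rotate σ (v i) (v j) (v l)] at e
    have p1 := mul_pos hm (sub_pos.2 xjl)
    have p2 := mul_pos (neg_pos.2 hneg) (sub_pos.2 xjm)
    by_contra hc
    have p3 := mul_nonneg (neg_nonneg.2 (not_lt.1 hc)) (sub_pos.2 xij).le
    nlinarith
  · by_contra hc
    obtain ⟨-, h4⟩ := hf.left m (by omega) (by omega)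
    have hiL := hb.left m (by omega) h2
    have h5 := h4 j h1
    have hm := hpos m (by omega) h2 (by omega)
    rcases hiL.eq_or_lt with h | h
    · rw [← h, orient_swap] at h5
      linarith
    · have hp := hpos (L m) h (by omega) (by omega)
      have xjm := hv.lt j m h1 (by omega)
      have xpj := hv.lt (L m) j (by omega) (by omega)
      have e := orient_pivot σ (v j) (v i) (v m) (v (L m))
      have e1 : orient σ (v j) (v i) (v m) = -orient σ (v i) (v j) (v m) := by
        unfold orient; ring
      have e2 : orient σ (v (L m)) (v m) (v j) = -orient σ (v j) (v m) (v (L m)) := by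
        unfold orient; ring
      rw [e1, orient_rotate σ (v i)] at e
      have p1 := mul_pos hm (sub_pos.2 xpj)
      have p2 := mul_pos hp (sub_pos.2 xjm)
      have p3 := mul_nonneg h5 (sub_pos.2 xij).le
      rw [e2] at p3
      nlinarith

/-- For a point over a base, the right end of the base lies below the line from the left vertex of
its triangle through the point. So a first point below that line exists. -/
lemma IsBase.orient_neg (hv : IsTerrain σ v n) (hb : IsBase σ v n L i l)
    (hij : i < j) (hjl : j < l) {p : ℕ} (hp : IsLeft σ v j p) :
    orient σ (v p) (v j) (v l) < 0 := by
  by_contra hc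
  have hln := hb.le
  obtain ⟨h1, h2⟩ := hp
  have h5 := hb.above j hij hjl
  have h6 := h2 i hij
  have xij := hv.lt i j hij (by omega)
  have xjl := hv.lt j l hjl (by omega)
  have xpj := hv.lt p j h1 (by omega)
  have e := orient_pivot σ (v j) (v p) (v i) (v l)
  have e1 : orient σ (v j) (v p) (v i) = -orient σ (v p) (v j) (v i) := by
    unfold orient; ring
  have e2 : orient σ (v j) (v i) (v l) = orient σ (v i) (v l) (v j) := by
    unfold orient; ring
  rw [e1, e2, orient_rotate σ (v p)] at e
  have p1 := mul_nonneg h6 (sub_pos.2 xjl).le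
  have p2 := mul_pos h5 (sub_pos.2 xpj)
  have p3 := mul_nonneg (not_lt.1 hc) (sub_pos.2 xij).le
  nlinarith

/-- The triangles over a base do not reach to the right of it. -/
lemma IsBase.right_le (hv : IsTerrain σ v n) (hf : IsFan σ v n L R) (hb : IsBase σ v n L i l)
    (hij : i < j) (hjl : j < l) : R j ≤ l := by
  by_contra hc
  have hln := hb.le
  obtain ⟨-, -, h3⟩ := hf.right j (by omega) (by omega)
  exact absurd (hb.orient_neg hv hij hjl (hf.left j (by omega) (by omega)))
    (not_lt.2 (h3 l hjl (by omega)))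

/-- A point `v i` below the line from `v l` to `v j` takes over as the one with the largest slope
to `v j`. -/
lemma IsTerrain.orient_nonneg_of_below (hv : IsTerrain σ v n) {m : ℕ} (hil : i < l) (hlj : l < j)
    (hj : j ≤ n) (hi : orient σ (v l) (v j) (v i) < 0) (hmj : m < j)
    (hm : 0 ≤ orient σ (v l) (v j) (v m)) : 0 ≤ orient σ (v i) (v j) (v m) := by
  by_contra hc
  have xij := hv.lt i j (by omega) hj
  have xlj := hv.lt l j hlj hj
  have xmj := hv.lt m j hmj hj
  have e : orient σ (v i) (v j) (v m) * (v j 0 - v l 0) =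
      orient σ (v l) (v j) (v m) * (v j 0 - v i 0)
        - orient σ (v l) (v j) (v i) * (v j 0 - v m 0) := by
    unfold orient; ring
  have p1 := mul_nonneg hm (sub_pos.2 xij).le
  have p2 := mul_pos (neg_pos.2 hi) (sub_pos.2 xmj)
  have p3 := mul_pos (neg_pos.2 (not_le.1 hc)) (sub_pos.2 xlj)
  nlinarith

/-- Induction over the bases that the triangles cut off. -/
lemma IsBase.induction (hv : IsTerrain σ v n) (hf : IsFan σ v n L R) {P : ℕ → ℕ → Prop}
    (edge : ∀ i, i + 1 ≤ n → P i (i + 1))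
    (apex : ∀ i j l, i < j → j < l → L j = i → R j = l → IsBase σ v n L i l →
      IsBase σ v n L i j → IsBase σ v n L j l → P i j → P j l → P i l) :
    ∀ {i l}, IsBase σ v n L i l → P i l := by
  suffices h : ∀ d i l, l - i ≤ d → IsBase σ v n L i l → P i l from
    fun {i l} hb => h _ i l le_rfl hb
  intro d
  induction d with
  | zero =>
    intro i l h hb
    have := hb.lt
    omega
  | succ d ih =>
    intro i l h hb
    have h1 := hb.lt
    rcases Nat.lt_or_ge (i + 1) l with h2 | h2
    · obtain ⟨j, hij, hjl, hL, hR, b1, b2⟩ := hb.exists_apex hv hf h2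
      exact apex i j l hij hjl hL hR hb b1 b2 (ih i j (by omega) b1) (ih j l (by omega) b2)
    · obtain rfl : l = i + 1 := by omega
      exact edge i hb.le

/-- The vertices of the triangle of `v j`. -/
def fanTriangle (L R : ℕ → ℕ) (j : ℕ) : Finset ℕ := {L j, j, R j}

lemma IsBase.fanTriangle_subset (hv : IsTerrain σ v n) (hf : IsFan σ v n L R)
    (hb : IsBase σ v n L i l) (hij : i < j) (hjl : j < l) {m : ℕ} (hm : m ∈ fanTriangle L R j) :
    i ≤ m ∧ m ≤ l := by
  have h1 := hb.right_le hv hf hij hjl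
  have h2 := hb.left j hij hjl
  have h3 := hb.le
  have h4 := (hf.left j (by omega) (by omega)).1
  have h5 := (hf.right j (by omega) (by omega)).1
  simp only [fanTriangle, Finset.mem_insert, Finset.mem_singleton] at hm
  omega

lemma IsBase.above_nonneg (hb : IsBase σ v n L i l) {m : ℕ} (h1 : i ≤ m) (h2 : m ≤ l) :
    0 ≤ orient σ (v i) (v l) (v m) := by
  rcases h1.eq_or_lt with rfl | h1
  · rw [orient_self_left]
  rcases h2.eq_or_lt with rfl | h2
  · rw [orient_self_right]
  exact (hb.above m h1 h2).le

lemma IsBase.eq_of_orient_eq_zero (hb : IsBase σ v n L i l) {m : ℕ} (h1 : i ≤ m) (h2 : m ≤ l)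
    (h : orient σ (v i) (v l) (v m) = 0) : m = i ∨ m = l := by
  by_contra hc
  have := hb.above m (by omega) (by omega)
  linarith

/-- Two triangles of the fan meet in the hull of their common vertices: triangles over different
sides of an apex are separated by the vertical line through the apex, and a triangle over a side
of another one is separated from it by that side. -/
lemma IsBase.inter_subset (hv : IsTerrain σ v n) (hf : IsFan σ v n L R)
    (hb : IsBase σ v n L i l) :
    ∀ j j', i < j → j < l → i < j' → j' < l →
      convexHull ℝ (v '' fanTriangle L R j) ∩ convexHull ℝ (v '' fanTriangle L R j') ⊆
        convexHull ℝ (v '' (fanTriangle L R j ∩ fanTriangle L R j' : Finset ℕ)) := by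
  -- the triangle of an apex `a` against a triangle over one of its short sides `(c, d)`
  have side : ∀ {a c d j}, IsBase σ v n L c d →
      (∀ m ∈ fanTriangle L R a, orient σ (v c) (v d) (v m) ≤ 0) →
      c ∈ fanTriangle L R a → d ∈ fanTriangle L R a → c < j → j < d →
      convexHull ℝ (v '' fanTriangle L R j) ∩ convexHull ℝ (v '' fanTriangle L R a) ⊆
        convexHull ℝ (v '' (fanTriangle L R j ∩ fanTriangle L R a : Finset ℕ)) := by
    intro a c d j hcd hneg hc hd h1 h2 x hx
    refine convexHull_mono ?_ ((isAffineFun_orient σ (v c) (v d)).mem_convexHull_of_separated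
      (fun m hm => ?_) hneg hx.1 hx.2).1
    · rintro _ ⟨m, ⟨hm, h0⟩, rfl⟩
      obtain ⟨h3, h4⟩ := hcd.fanTriangle_subset hv hf h1 h2 hm
      refine ⟨m, ?_, rfl⟩
      rw [Finset.coe_inter]
      refine ⟨hm, ?_⟩
      rcases hcd.eq_of_orient_eq_zero h3 h4 h0 with rfl | rfl
      · exact hc
      · exact hd
    · obtain ⟨h3, h4⟩ := hcd.fanTriangle_subset hv hf h1 h2 hm
      exact hcd.above_nonneg h3 h4
  have symm : ∀ {j j'}, convexHull ℝ (v '' fanTriangle L R j) ∩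
      convexHull ℝ (v '' fanTriangle L R j') ⊆
        convexHull ℝ (v '' (fanTriangle L R j ∩ fanTriangle L R j' : Finset ℕ)) →
      convexHull ℝ (v '' fanTriangle L R j') ∩ convexHull ℝ (v '' fanTriangle L R j) ⊆
        convexHull ℝ (v '' (fanTriangle L R j' ∩ fanTriangle L R j : Finset ℕ)) := by
    intro j j' h
    rwa [Set.inter_comm, Finset.inter_comm]
  refine hb.induction hv hf (P := fun i l => ∀ j j', i < j → j < l → i < j' → j' < l →
      convexHull ℝ (v '' fanTriangle L R j) ∩ convexHull ℝ (v '' fanTriangle L R j') ⊆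
        convexHull ℝ (v '' (fanTriangle L R j ∩ fanTriangle L R j' : Finset ℕ))) ?_ ?_
  · intros; omega
  · intro i a l hia hal hL hR hb b1 b2 ih1 ih2
    have hln := hb.le
    have hneg : orient σ (v i) (v a) (v l) < 0 := by
      have := hb.above a hia hal
      rw [orient_swap] at this
      linarith
    have hmem : ∀ m, m ∈ fanTriangle L R a ↔ m = i ∨ m = a ∨ m = l := by
      intro m
      simp [fanTriangle, hL, hR]
    have left : ∀ j, i < j → j < a → convexHull ℝ (v '' fanTriangle L R j) ∩
        convexHull ℝ (v '' fanTriangle L R a) ⊆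
        convexHull ℝ (v '' (fanTriangle L R j ∩ fanTriangle L R a : Finset ℕ)) := by
      intro j h1 h2
      refine side b1 ?_ ((hmem _).2 (by simp)) ((hmem _).2 (by simp)) h1 h2
      intro m hm
      rcases (hmem m).1 hm with rfl | rfl | rfl
      · rw [orient_self_left]
      · rw [orient_self_right]
      · exact hneg.le
    have right : ∀ j, a < j → j < l → convexHull ℝ (v '' fanTriangle L R j) ∩
        convexHull ℝ (v '' fanTriangle L R a) ⊆
        convexHull ℝ (v '' (fanTriangle L R j ∩ fanTriangle L R a : Finset ℕ)) := by
      intro j h1 h2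
      refine side b2 ?_ ((hmem _).2 (by simp)) ((hmem _).2 (by simp)) h1 h2
      intro m hm
      rcases (hmem m).1 hm with rfl | rfl | rfl
      · rw [orient_rotate]
        exact hneg.le
      · rw [orient_self_left]
      · rw [orient_self_right]
    have cross : ∀ j j', i < j → j < a → a < j' → j' < l →
        convexHull ℝ (v '' fanTriangle L R j) ∩ convexHull ℝ (v '' fanTriangle L R j') ⊆
        convexHull ℝ (v '' (fanTriangle L R j ∩ fanTriangle L R j' : Finset ℕ)) := by
      intro j j' h1 h2 h3 h4 x hx
      obtain ⟨hx1, hx2⟩ := (isAffineFun_abscissa (v a 0)).mem_convexHull_of_separated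
        (t := fanTriangle L R j') (t' := fanTriangle L R j)
        (fun m hm => sub_nonneg.2 (hv.le (b2.fanTriangle_subset hv hf h3 h4 hm).1
          ((b2.fanTriangle_subset hv hf h3 h4 hm).2.trans hln)))
        (fun m hm => sub_nonpos.2 (hv.le (b1.fanTriangle_subset hv hf h1 h2 hm).2 b1.le))
        hx.2 hx.1
      have key : ∀ t : Finset ℕ, (∀ m ∈ t, m ≤ n) →
          x ∈ convexHull ℝ (v '' {m | m ∈ t ∧ v m 0 - v a 0 = 0}) →
          a ∈ t ∧ x ∈ convexHull ℝ (v '' {a}) := by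
        intro t ht hx
        have hsub : ∀ m, m ∈ t ∧ v m 0 - v a 0 = 0 → m = a := fun m hm =>
          hv.index_eq (ht m hm.1) b1.le (by linarith [hm.2])
        refine ⟨?_, convexHull_mono (Set.image_mono hsub) hx⟩
        obtain ⟨_, m, hm, -⟩ := convexHull_nonempty_iff.1 ⟨x, hx⟩
        exact hsub m hm ▸ hm.1
      obtain ⟨m1, -⟩ := key _ (fun m hm => (b2.fanTriangle_subset hv hf h3 h4 hm).2.trans hln) hx1
      obtain ⟨m2, m3⟩ := key _
        (fun m hm => (b1.fanTriangle_subset hv hf h1 h2 hm).2.trans b1.le) hx2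
      refine convexHull_mono (Set.image_mono ?_) m3
      simp [m1, m2]
    intro j j' h1 h2 h3 h4
    rcases lt_trichotomy j a with h | h | h <;> rcases lt_trichotomy j' a with h' | h' | h'
    · exact ih1 j j' h1 h h3 h'
    · exact h' ▸ left j h1 h
    · exact cross j j' h1 h h' h4
    · exact h ▸ symm (left j' h3 h')
    · subst h h'
      simp
    · exact h ▸ symm (right j' h' h4)
    · exact symm (cross j' j h3 h' h h2)
    · exact h' ▸ right j h h2
    · exact ih2 j j' h h2 h' h4

/-! ### The region under the chain -/

/-- The point `q` is not above the chain `v 0, …, v n`. -/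
def BelowChain (σ : ℝ) (v : ℕ → Plane) (n : ℕ) (q : Plane) : Prop :=
  ∀ m < n, v m 0 ≤ q 0 → q 0 ≤ v (m + 1) 0 → orient σ (v m) (v (m + 1)) q ≤ 0

/-- The points between the chain and the segment from `v i` to `v l`. -/
def chainRegion (σ : ℝ) (v : ℕ → Plane) (n i l : ℕ) : Set Plane :=
  {q | v i 0 ≤ q 0 ∧ q 0 ≤ v l 0 ∧ 0 ≤ orient σ (v i) (v l) q ∧ BelowChain σ v n q}

lemma IsTerrain.belowChain (hv : IsTerrain σ v n) (hij : i < j) (hj : j ≤ n)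
    (hab : ∀ m, i ≤ m → m ≤ j → 0 ≤ orient σ (v i) (v j) (v m)) {q : Plane}
    (h1 : v i 0 ≤ q 0) (h2 : q 0 ≤ v j 0) (h : orient σ (v i) (v j) q ≤ 0) :
    BelowChain σ v n q := by
  intro m hm h3 h4
  have xij := hv.lt i j hij hj
  have xm := hv.lt m (m + 1) (by omega) hm
  -- the value of `q` relative to edge `m`, in terms of the line `i j`
  have key : orient σ (v m) (v (m + 1)) q * (v j 0 - v i 0) =
      orient σ (v i) (v j) q * (v (m + 1) 0 - v m 0)
        - orient σ (v i) (v j) (v m) * (v (m + 1) 0 - q 0)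
        - orient σ (v i) (v j) (v (m + 1)) * (q 0 - v m 0) := by
    unfold orient; ring
  have hp := mul_nonneg (neg_nonneg.2 h) (sub_pos.2 xm).le
  rcases Nat.lt_or_ge m i with hmi | hmi
  · have hq : q 0 = v (m + 1) 0 :=
      le_antisymm h4 ((hv.le (by omega) (by omega)).trans h1)
    obtain rfl : m + 1 = i := hv.index_eq hm (by omega)
      (le_antisymm (hv.le (by omega) (by omega)) (h1.trans h4))
    rw [orient_self_left, hq] at key
    by_contra hc
    nlinarith [mul_pos (not_le.1 hc) (sub_pos.2 xij)]
  rcases Nat.lt_or_ge m j with hmj | hmj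
  · by_contra hc
    nlinarith [mul_pos (not_le.1 hc) (sub_pos.2 xij),
      mul_nonneg (hab m hmi hmj.le) (sub_nonneg.2 h4),
      mul_nonneg (hab (m + 1) (by omega) hmj) (sub_nonneg.2 h3)]
  · have hq : q 0 = v m 0 :=
      le_antisymm (h2.trans (hv.le (by omega) (by omega))) h3
    obtain rfl : m = j := hv.index_eq hm.le hj
      (le_antisymm (h3.trans h2) (hv.le (by omega) (by omega)))
    rw [orient_self_right, hq] at key
    by_contra hc
    nlinarith [mul_pos (not_le.1 hc) (sub_pos.2 xij)]

/-- The triangles of the points above a base fill the region between the base and the chain. -/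
lemma IsBase.chainRegion_eq (hv : IsTerrain σ v n) (hf : IsFan σ v n L R)
    (hb : IsBase σ v n L i l) :
    chainRegion σ v n i l = segment ℝ (v i) (v l) ∪
      ⋃ j ∈ Set.Ioo i l, convexHull ℝ (v '' fanTriangle L R j) := by
  refine hb.induction hv hf (P := fun i l => chainRegion σ v n i l = segment ℝ (v i) (v l) ∪
      ⋃ j ∈ Set.Ioo i l, convexHull ℝ (v '' fanTriangle L R j)) ?_ ?_
  · intro i hi
    have hIoo : Set.Ioo i (i + 1) = ∅ := by ext; simp
    have hx := hv.lt i (i + 1) (by omega) hi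
    ext q
    rw [hIoo, Set.biUnion_empty, Set.union_empty, mem_segment_iff_orient hv.sign hx]
    constructor
    · rintro ⟨h1, h2, h3, h4⟩
      exact ⟨h1, h2, le_antisymm (h4 i hi h1 h2) h3⟩
    · rintro ⟨h1, h2, h3⟩
      refine ⟨h1, h2, h3.ge, hv.belowChain (i.lt_succ_self) hi ?_ h1 h2 h3.le⟩
      intro m h4 h5
      obtain rfl | rfl : m = i ∨ m = i + 1 := by omega
      · rw [orient_self_left]
      · rw [orient_self_right]
  · intro i a l hia hal hL hR hb b1 b2 ih1 ih2
    have hln := hb.le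
    have xia := hv.lt i a hia (by omega)
    have xal := hv.lt a l hal (by omega)
    have hneg : orient σ (v i) (v a) (v l) < 0 := by
      have := hb.above a hia hal
      rw [orient_swap] at this
      linarith
    have hset : v '' fanTriangle L R a = {v i, v a, v l} := by
      simp [fanTriangle, hL, hR, Set.image_insert_eq]
    have htri : ∀ q, q ∈ convexHull ℝ (v '' fanTriangle L R a) ↔
        0 ≤ orient σ (v i) (v l) q ∧ orient σ (v i) (v a) q ≤ 0 ∧
          orient σ (v a) (v l) q ≤ 0 := by
      intro q
      rw [hset]
      exact mem_convexHull_triangle_iff hneg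
    have hseg : ∀ c d, c ∈ fanTriangle L R a → d ∈ fanTriangle L R a →
        segment ℝ (v c) (v d) ⊆ convexHull ℝ (v '' fanTriangle L R a) := fun c d hc hd =>
      segment_subset_convexHull ⟨c, hc, rfl⟩ ⟨d, hd, rfl⟩
    have mi : i ∈ fanTriangle L R a := by simp [fanTriangle, hL]
    have ma : a ∈ fanTriangle L R a := by simp [fanTriangle]
    have ml : l ∈ fanTriangle L R a := by simp [fanTriangle, hR]
    have hsplit : (⋃ j ∈ Set.Ioo i l, convexHull ℝ (v '' fanTriangle L R j)) =
        convexHull ℝ (v '' fanTriangle L R a) ∪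
        ((⋃ j ∈ Set.Ioo i a, convexHull ℝ (v '' fanTriangle L R j)) ∪
        ⋃ j ∈ Set.Ioo a l, convexHull ℝ (v '' fanTriangle L R j)) := by
      have : Set.Ioo i l = {a} ∪ (Set.Ioo i a ∪ Set.Ioo a l) := by
        ext m
        simp only [Set.mem_Ioo, Set.mem_union, Set.mem_singleton_iff]
        omega
      rw [this, Set.biUnion_union, Set.biUnion_union, Set.biUnion_singleton]
    have hreg : chainRegion σ v n i l = convexHull ℝ (v '' fanTriangle L R a) ∪
        (chainRegion σ v n i a ∪ chainRegion σ v n a l) := by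
      -- relation between the three sides at a point `q`
      have rel : ∀ q : Plane, orient σ (v i) (v l) q =
          orient σ (v i) (v a) q + orient σ (v a) (v l) q - orient σ (v i) (v a) (v l) := by
        intro q; unfold orient; ring
      -- the long side seen from a point on the left or on the right of the apex
      have rel1 : ∀ q : Plane, orient σ (v a) (v l) q * (v a 0 - v i 0) =
          orient σ (v i) (v a) q * (v l 0 - v a 0)
            + orient σ (v i) (v a) (v l) * (v a 0 - q 0) := by
        intro q; unfold orient; ring
      have rel2 : ∀ q : Plane, orient σ (v i) (v l) q * (v a 0 - v i 0) =
          orient σ (v i) (v a) q * (v l 0 - v i 0)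
            - orient σ (v i) (v a) (v l) * (q 0 - v i 0) := by
        intro q; unfold orient; ring
      have rel3 : ∀ q : Plane, orient σ (v i) (v l) q * (v l 0 - v a 0) =
          orient σ (v a) (v l) q * (v l 0 - v i 0)
            - orient σ (v i) (v a) (v l) * (v l 0 - q 0) := by
        intro q; unfold orient; ring
      ext q
      constructor
      · rintro ⟨h1, h2, h3, h4⟩
        rcases le_total (q 0) (v a 0) with h5 | h5
        · rcases le_total 0 (orient σ (v i) (v a) q) with h6 | h6
          · exact Or.inr (Or.inl ⟨h1, h5, h6, h4⟩)
          · refine Or.inl ((htri q).2 ⟨h3, h6, ?_⟩)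
            by_contra hc
            nlinarith [rel1 q, mul_pos (not_le.1 hc) (sub_pos.2 xia),
              mul_nonneg (neg_nonneg.2 h6) (sub_pos.2 xal).le,
              mul_nonneg (neg_pos.2 hneg).le (sub_nonneg.2 h5)]
        · rcases le_total 0 (orient σ (v a) (v l) q) with h6 | h6
          · exact Or.inr (Or.inr ⟨h5, h2, h6, h4⟩)
          · refine Or.inl ((htri q).2 ⟨h3, ?_, h6⟩)
            by_contra hc
            nlinarith [rel1 q, mul_pos (not_le.1 hc) (sub_pos.2 xal),
              mul_nonneg (neg_nonneg.2 h6) (sub_pos.2 xia).le,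
              mul_nonneg (neg_pos.2 hneg).le (sub_nonneg.2 h5)]
      · rintro (h | h | h)
        · have h1 : v i 0 ≤ q 0 := by
            have := (isAffineFun_abscissa (v i 0)).nonneg_of_mem_convexHull ?_ h
            · linarith
            · rw [hset]
              rintro x (rfl | rfl | rfl) <;> linarith
          have h2 : q 0 ≤ v l 0 := by
            have := (isAffineFun_abscissa (v l 0)).nonpos_of_mem_convexHull ?_ h
            · linarith
            · rw [hset]
              rintro x (rfl | rfl | rfl) <;> linarith
          obtain ⟨h3, h4, h5⟩ := (htri q).1 h
          refine ⟨h1, h2, h3, ?_⟩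
          rcases le_total (q 0) (v a 0) with h6 | h6
          · exact hv.belowChain hia (by omega) (fun m => b1.above_nonneg) h1 h6 h4
          · exact hv.belowChain hal (by omega) (fun m => b2.above_nonneg) h6 h2 h5
        · obtain ⟨h1, h2, h3, h4⟩ := h
          refine ⟨h1, h2.trans xal.le, ?_, h4⟩
          by_contra hc
          nlinarith [rel2 q, mul_pos (neg_pos.2 (not_le.1 hc)) (sub_pos.2 xia),
            mul_nonneg h3 (sub_pos.2 (xia.trans xal)).le,
            mul_nonneg (neg_pos.2 hneg).le (sub_nonneg.2 h1)]
        · obtain ⟨h1, h2, h3, h4⟩ := h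
          refine ⟨xia.le.trans h1, h2, ?_, h4⟩
          by_contra hc
          nlinarith [rel3 q, mul_pos (neg_pos.2 (not_le.1 hc)) (sub_pos.2 xal),
            mul_nonneg h3 (sub_pos.2 (xia.trans xal)).le,
            mul_nonneg (neg_pos.2 hneg).le (sub_nonneg.2 h2)]
    rw [hreg, hsplit, ih1, ih2]
    have s1 := hseg i a mi ma
    have s2 := hseg a l ma ml
    have s3 := hseg i l mi ml
    refine Set.Subset.antisymm ?_ ?_
    · rintro q (h | (h | h) | (h | h))
      exacts [Or.inr (Or.inl h), Or.inr (Or.inl (s1 h)), Or.inr (Or.inr (Or.inl h)),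
        Or.inr (Or.inl (s2 h)), Or.inr (Or.inr (Or.inr h))]
    · rintro q (h | h | h | h)
      exacts [Or.inl (s3 h), Or.inl h, Or.inr (Or.inl (Or.inr h)), Or.inr (Or.inr (Or.inr h))]

/-- As soon as there is a triangle, the base itself is covered. -/
lemma IsBase.chainRegion_eq_iUnion (hv : IsTerrain σ v n) (hf : IsFan σ v n L R)
    (hb : IsBase σ v n L i l) (hil : i + 1 < l) :
    chainRegion σ v n i l = ⋃ j ∈ Set.Ioo i l, convexHull ℝ (v '' fanTriangle L R j) := by
  rw [hb.chainRegion_eq hv hf, Set.union_eq_right]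
  obtain ⟨a, hia, hal, hL, hR, -, -⟩ := hb.exists_apex hv hf hil
  have mi : i ∈ fanTriangle L R a := by simp [fanTriangle, hL]
  have ml : l ∈ fanTriangle L R a := by simp [fanTriangle, hR]
  have h : segment ℝ (v i) (v l) ⊆ convexHull ℝ (v '' fanTriangle L R a) :=
    segment_subset_convexHull ⟨i, mi, rfl⟩ ⟨l, ml, rfl⟩
  exact h.trans
    (Set.subset_biUnion_of_mem (u := fun j => convexHull ℝ (v '' fanTriangle L R j)) ⟨hia, hal⟩)

end Chain

/-! ### The closed region of a mountain -/

/-- The closed polygonal curve formed by a chain and the segment between its end points. -/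
def chainBoundary (v : ℕ → Plane) (n : ℕ) : Set Plane :=
  (⋃ m ∈ Set.Iio n, segment ℝ (v m) (v (m + 1))) ∪ segment ℝ (v 0) (v n)

lemma orient_add_single (σ t : ℝ) (p r q : Plane) :
    orient σ p r (q + EuclideanSpace.single 1 t) = orient σ p r q + σ * t * (r 0 - p 0) := by
  simp only [orient, PiLp.add_apply, PiLp.single_apply]
  simp
  ring

/-- A vertical ray outside a set lies in an unbounded component of the complement. -/
lemma not_isBounded_connectedComponentIn_of_ray {B : Set Plane} {q : Plane} {c : ℝ}
    (hc : c * c = 1) (h : ∀ s : ℝ, 0 ≤ s → q + EuclideanSpace.single 1 (s * c) ∉ B) :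
    ¬ Bornology.IsBounded (connectedComponentIn Bᶜ q) := by
  intro hb
  set f : ℝ → Plane := fun s => q + s • EuclideanSpace.single 1 c with hf
  have hf' : ∀ s, f s = q + EuclideanSpace.single 1 (s * c) := by
    intro s
    ext l
    fin_cases l <;> simp [hf]
  have hray : f '' Set.Ici 0 ⊆ connectedComponentIn Bᶜ q := by
    refine IsPreconnected.subset_connectedComponentIn ?_ ⟨0, Set.self_mem_Ici, by simp [hf]⟩ ?_
    · exact isPreconnected_Ici.image f (by fun_prop)
    · rintro _ ⟨s, hs, rfl⟩
      rw [hf']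
      exact h s hs
  obtain ⟨C, hC⟩ := isBounded_iff_forall_norm_le.1 hb
  have hC0 : 0 ≤ C := (norm_nonneg _).trans (hC _ (hray ⟨0, Set.self_mem_Ici, rfl⟩))
  have h1 := hC _ (hray ⟨C + |q 1| + 1, by simp only [Set.mem_Ici]; positivity, rfl⟩)
  have h2 := (PiLp.norm_apply_le (f (C + |q 1| + 1)) 1).trans h1
  rw [hf', PiLp.add_apply, PiLp.single_apply, if_pos rfl, Real.norm_eq_abs] at h2
  have h3 : |c| = 1 := by
    have : |c| * |c| = 1 := by rw [← abs_mul, hc, abs_one]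
    nlinarith [abs_nonneg c]
  have h4 : |(C + |q 1| + 1) * c| = C + |q 1| + 1 := by
    rw [abs_mul, h3, mul_one, abs_of_nonneg (by positivity)]
  have h5 := abs_sub_abs_le_abs_sub ((C + |q 1| + 1) * c) (-q 1)
  rw [abs_neg, h4, sub_neg_eq_add, add_comm _ (q 1)] at h5
  linarith

section Region

variable {σ : ℝ} {v : ℕ → Plane} {n : ℕ} {L R : ℕ → ℕ}

lemma IsTerrain.base_nonneg (hv : IsTerrain σ v n) {m : ℕ} (hm : m ≤ n) :
    0 ≤ orient σ (v 0) (v n) (v m) :=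
  (hv.isBase (L := fun _ => 0)).above_nonneg (Nat.zero_le m) hm

lemma IsTerrain.chainBoundary_subset (hv : IsTerrain σ v n) :
    chainBoundary v n ⊆ chainRegion σ v n 0 n := by
  rintro q (hq | hq)
  · simp only [Set.mem_iUnion, Set.mem_Iio, exists_prop] at hq
    obtain ⟨m, hm, hq⟩ := hq
    obtain ⟨h1, h2, h3⟩ := (mem_segment_iff_orient hv.sign (hv.lt m (m + 1) (by omega) hm)).1 hq
    refine ⟨(hv.le (Nat.zero_le m) hm.le).trans h1, h2.trans (hv.le hm le_rfl), ?_,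
      hv.belowChain m.lt_succ_self hm ?_ h1 h2 h3.le⟩
    · rw [← convexHull_pair] at hq
      refine (isAffineFun_orient σ (v 0) (v n)).nonneg_of_mem_convexHull ?_ hq
      rintro x (rfl | rfl)
      · exact hv.base_nonneg hm.le
      · exact hv.base_nonneg hm
    · intro l h4 h5
      obtain rfl | rfl : l = m ∨ l = m + 1 := by omega
      · rw [orient_self_left]
      · rw [orient_self_right]
  · obtain ⟨h1, h2, h3⟩ := (mem_segment_iff_orient hv.sign (hv.lt 0 n hv.pos le_rfl)).1 hq
    exact ⟨h1, h2, h3.ge, hv.belowChain hv.pos le_rfl (fun m _ hm => hv.base_nonneg hm) h1 h2 h3.le⟩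

lemma IsTerrain.isCompact_chainRegion (hv : IsTerrain σ v n) (hf : IsFan σ v n L R) :
    IsCompact (chainRegion σ v n 0 n) := by
  rw [(hv.isBase (L := L)).chainRegion_eq hv hf]
  refine IsCompact.union ?_ ((Set.finite_Ioo 0 n).isCompact_biUnion fun j _ => ?_)
  · rw [← convexHull_pair]
    exact (Set.toFinite _).isCompact_convexHull ℝ
  · exact ((Finset.finite_toSet _).image v).isCompact_convexHull ℝ

/-- The points strictly inside the curve. Written with an implication for each edge, this set is
open because it is a finite intersection of complements of closed sets. -/
def chainInterior (σ : ℝ) (v : ℕ → Plane) (n : ℕ) : Set Plane :=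
  {q | v 0 0 < q 0 ∧ q 0 < v n 0 ∧ 0 < orient σ (v 0) (v n) q ∧
    ∀ m ∈ Set.Iio n, v m 0 ≤ q 0 → q 0 ≤ v (m + 1) 0 → orient σ (v m) (v (m + 1)) q < 0}

lemma isOpen_chainInterior : IsOpen (chainInterior σ v n) := by
  have hcont : ∀ p r : Plane, Continuous (orient σ p r) := by
    intro p r
    unfold orient
    fun_prop
  have h0 : Continuous fun q : Plane => q 0 := by fun_prop
  have e : chainInterior σ v n = {q | v 0 0 < q 0} ∩ ({q | q 0 < v n 0} ∩
      ({q | 0 < orient σ (v 0) (v n) q} ∩ ⋂ m ∈ Set.Iio n,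
        ({q | v m 0 ≤ q 0} ∩ ({q | q 0 ≤ v (m + 1) 0} ∩
          {q | 0 ≤ orient σ (v m) (v (m + 1)) q}))ᶜ)) := by
    ext q
    simp [chainInterior]
  rw [e]
  refine (isOpen_lt continuous_const h0).inter ((isOpen_lt h0 continuous_const).inter
    ((isOpen_lt continuous_const (hcont _ _)).inter
      ((Set.finite_Iio n).isOpen_biInter fun m _ => ?_)))
  exact ((isClosed_le continuous_const h0).inter ((isClosed_le h0 continuous_const).inter
    (isClosed_le continuous_const (hcont _ _)))).isOpen_compl

lemma chainInterior_subset : chainInterior σ v n ⊆ chainRegion σ v n 0 n :=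
  fun _ ⟨h1, h2, h3, h4⟩ => ⟨h1.le, h2.le, h3.le, fun m hm h5 h6 => (h4 m hm h5 h6).le⟩

lemma IsTerrain.mem_chainInterior (hv : IsTerrain σ v n) {q : Plane}
    (hq : q ∈ chainRegion σ v n 0 n) (hqB : q ∉ chainBoundary v n) : q ∈ chainInterior σ v n := by
  obtain ⟨h1, h2, h3, h4⟩ := hq
  have hpos := hv.pos
  have x0n := hv.lt 0 n hpos le_rfl
  have hbase : orient σ (v 0) (v n) q ≠ 0 := fun h =>
    hqB (Or.inr ((mem_segment_iff_orient hv.sign x0n).2 ⟨h1, h2, h⟩))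
  have hedge : ∀ m < n, v m 0 ≤ q 0 → q 0 ≤ v (m + 1) 0 →
      orient σ (v m) (v (m + 1)) q ≠ 0 := fun m hm h5 h6 h =>
    hqB (Or.inl (Set.mem_biUnion (x := m) hm ((mem_segment_iff_orient hv.sign
      (hv.lt m (m + 1) (by omega) hm)).2 ⟨h5, h6, h⟩)))
  have hbase' := lt_of_le_of_ne h3 hbase.symm
  have hedge' : ∀ m < n, v m 0 ≤ q 0 → q 0 ≤ v (m + 1) 0 →
      orient σ (v m) (v (m + 1)) q < 0 := fun m hm h5 h6 =>
    lt_of_le_of_ne (h4 m hm h5 h6) (hedge m hm h5 h6)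
  refine ⟨lt_of_le_of_ne h1 fun h => ?_, lt_of_le_of_ne h2 fun h => ?_, hbase', hedge'⟩
  -- above the left end point there is no room between the base and the first edge
  · have x01 := hv.lt 0 (0 + 1) (by omega) (by omega)
    have h5 := hedge' 0 hpos h.le (h ▸ x01.le)
    unfold orient at h5 hbase'
    rw [← h] at h5 hbase'
    have h6 : 0 < (σ * (q 1 - v 0 1)) * (v n 0 - v 0 0) := by linarith
    have h7 : 0 < (-(σ * (q 1 - v 0 1))) * (v (0 + 1) 0 - v 0 0) := by linarith
    linarith [pos_of_mul_pos_left h6 (by linarith), pos_of_mul_pos_left h7 (by linarith)]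
  · obtain ⟨m, rfl⟩ : ∃ m, n = m + 1 := ⟨n - 1, by omega⟩
    have xm := hv.lt m (m + 1) (by omega) le_rfl
    have h5 := hedge' m (by omega) (h ▸ xm.le) h.le
    unfold orient at h5 hbase'
    rw [h] at h5 hbase'
    have h6 : 0 < (σ * (q 1 - v (m + 1) 1)) * (v (m + 1) 0 - v 0 0) := by linarith
    have h7 : 0 < (-(σ * (q 1 - v (m + 1) 1))) * (v (m + 1) 0 - v m 0) := by linarith
    linarith [pos_of_mul_pos_left h6 (by linarith), pos_of_mul_pos_left h7 (by linarith)]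

lemma IsTerrain.not_isBounded_of_notMem (hv : IsTerrain σ v n) {q : Plane}
    (hq : q ∉ chainRegion σ v n 0 n) :
    ¬ Bornology.IsBounded (connectedComponentIn (chainBoundary v n)ᶜ q) := by
  have hσ := hv.sign
  have key : ∀ c : ℝ, c * c = 1 →
      (∀ s : ℝ, 0 ≤ s → q + EuclideanSpace.single 1 (s * c) ∉ chainRegion σ v n 0 n) →
      ¬ Bornology.IsBounded (connectedComponentIn (chainBoundary v n)ᶜ q) := fun c hc h =>
    not_isBounded_connectedComponentIn_of_ray hc fun s hs hB => h s hs (hv.chainBoundary_subset hB)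
  have hx : ∀ t : ℝ, (q + EuclideanSpace.single 1 t : Plane) 0 = q 0 := by
    intro t
    simp
  by_cases h1 : v 0 0 ≤ q 0
  swap
  · refine key σ hσ fun s _ h => h1 ?_
    have := h.1
    rwa [hx] at this
  by_cases h2 : q 0 ≤ v n 0
  swap
  · refine key σ hσ fun s _ h => h2 ?_
    have := h.2.1
    rwa [hx] at this
  by_cases h3 : 0 ≤ orient σ (v 0) (v n) q
  · have h4 : ¬ BelowChain σ v n q := fun h => hq ⟨h1, h2, h3, h⟩
    unfold BelowChain at h4
    push Not at h4
    obtain ⟨m, hm, h5, h6, h7⟩ := h4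
    refine key σ hσ fun s hs h => ?_
    have h8 := h.2.2.2 m hm (by rwa [hx]) (by rwa [hx])
    have xm := hv.lt m (m + 1) (by omega) hm
    rw [orient_add_single, show σ * (s * σ) = s by rw [mul_left_comm, hσ, mul_one]] at h8
    linarith [mul_nonneg hs (sub_pos.2 xm).le]
  · refine key (-σ) (by linarith) fun s hs h => ?_
    have h8 := h.2.2.1
    have xm := hv.lt 0 n hv.pos le_rfl
    rw [orient_add_single, show σ * (s * -σ) = -s by linear_combination -s * hσ] at h8
    linarith [mul_nonneg hs (sub_pos.2 xm).le]

/-- The region enclosed by the curve is the region between the base and the chain. -/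
lemma IsTerrain.region_eq (hv : IsTerrain σ v n) (hf : IsFan σ v n L R) :
    chainBoundary v n ∪ {q | q ∉ chainBoundary v n ∧
      Bornology.IsBounded (connectedComponentIn (chainBoundary v n)ᶜ q)} =
      chainRegion σ v n 0 n := by
  refine Set.Subset.antisymm (Set.union_subset hv.chainBoundary_subset ?_) fun q hq => ?_
  · rintro q ⟨-, hq⟩
    by_contra h
    exact hv.not_isBounded_of_notMem h hq
  · by_cases hB : q ∈ chainBoundary v n
    · exact Or.inl hB
    have hK := hv.isCompact_chainRegion hf
    refine Or.inr ⟨hB, hK.isBounded.subset (Set.Subset.trans ?_ chainInterior_subset)⟩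
    refine isPreconnected_connectedComponentIn.subset_left_of_subset_union
      isOpen_chainInterior hK.isClosed.isOpen_compl ?_ ?_ ?_
    · exact Set.disjoint_compl_right_iff_subset.2 chainInterior_subset
    · intro x hx
      by_cases hxR : x ∈ chainRegion σ v n 0 n
      · exact Or.inl (hv.mem_chainInterior hxR (connectedComponentIn_subset _ _ hx))
      · exact Or.inr hxR
    · exact ⟨q, mem_connectedComponentIn hB, hv.mem_chainInterior hq hB⟩

end Region

/-! ### Listing the vertices of a mountain from left to right -/

/-- One step along the polygon, in the stored direction or against it. -/
def stepPerm (k : ℕ) (fwd : Bool) : Equiv.Perm (Fin k) :=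
  if fwd then finRotate k else (finRotate k).symm

/-- `a` runs through the vertices of `H` by increasing abscissas, in the stored direction or
against it. -/
structure IsTraversal {k : ℕ} (H : Polygon Plane k) (fwd : Bool) (a : ℕ → Fin k) : Prop where
  succ : ∀ i, a (i + 1) = stepPerm k fwd (a i)
  period : a k = a 0
  lt : ∀ i j, i < j → j < k → H (a i) 0 < H (a j) 0

lemma IsMountain.exists_traversal {k : ℕ} {H : Polygon Plane k} (h : IsMountain H) :
    ∃ fwd a, IsTraversal H fwd a := by
  obtain ⟨hs, r, hr⟩ := h
  obtain ⟨n, rfl⟩ : ∃ n, k = n + 1 := ⟨k - 1, by have := hs.three_le; omega⟩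
  have hsucc : ∀ i (h : i + 1 < n + 1),
      (⟨i + 1, h⟩ : Fin (n + 1)) = ⟨i, by omega⟩ + 1 := by
    intro i h
    ext
    rw [Fin.val_add_one_of_lt' (by simpa using h)]
  have hlast : (Fin.last n + 1 : Fin (n + 1)) = 0 := Fin.last_add_one n
  rcases hr with hr | hr
  · have key : ∀ i (h : i < n + 1), (stepPerm (n + 1) true)^[i] r = r + ⟨i, h⟩ := by
      intro i
      induction i with
      | zero => intro h; simp
      | succ i ih =>
        intro h
        rw [Function.iterate_succ_apply', ih (by omega), hsucc i h, ← add_assoc]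
        change finRotate (n + 1) _ = _
        rw [finRotate_apply]
    refine ⟨true, fun i => (stepPerm (n + 1) true)^[i] r,
      ⟨fun i => Function.iterate_succ_apply' .., ?_, fun i j hij hj => ?_⟩⟩
    · simp only [Function.iterate_zero, id]
      rw [Function.iterate_succ_apply', key n (by omega)]
      change finRotate (n + 1) (r + Fin.last n) = r
      rw [finRotate_apply, add_assoc, hlast, add_zero]
    · simp only [key j hj, key i (hij.trans hj)]
      exact hr (Fin.mk_lt_mk.2 hij)
  · have key : ∀ i (h : i < n + 1), (stepPerm (n + 1) false)^[i] r = r - ⟨i, h⟩ := by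
      intro i
      induction i with
      | zero => intro h; simp
      | succ i ih =>
        intro h
        rw [Function.iterate_succ_apply', ih (by omega), hsucc i h, sub_add_eq_sub_sub]
        change (finRotate (n + 1)).symm _ = _
        rw [finRotate_symm_apply]
    refine ⟨false, fun i => (stepPerm (n + 1) false)^[i] r,
      ⟨fun i => Function.iterate_succ_apply' .., ?_, fun i j hij hj => ?_⟩⟩
    · simp only [Function.iterate_zero, id]
      rw [Function.iterate_succ_apply', key n (by omega)]
      change (finRotate (n + 1)).symm (r - Fin.last n) = r
      rw [finRotate_symm_apply, ← sub_add_eq_sub_sub, hlast, sub_zero]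
    · simp only [key j hj, key i (hij.trans hj)]
      exact hr (Fin.mk_lt_mk.2 hij)

section Traversal

variable {k : ℕ} {H : Polygon Plane k} {fwd : Bool} {a : ℕ → Fin k} {i j : ℕ}

lemma IsTraversal.inj (ha : IsTraversal H fwd a) (hi : i < k) (hj : j < k) (h : a i = a j) :
    i = j := by
  rcases lt_trichotomy i j with h' | h' | h'
  · exact absurd (ha.lt i j h' hj) (by rw [h]; exact lt_irrefl _)
  · exact h'
  · exact absurd (ha.lt j i h' hi) (by rw [h]; exact lt_irrefl _)

lemma IsTraversal.surj (ha : IsTraversal H fwd a) (p : Fin k) : ∃ i < k, a i = p := by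
  have hinj : Function.Injective fun i : Fin k => a i := fun i j h =>
    Fin.ext (ha.inj i.2 j.2 h)
  obtain ⟨i, hi⟩ := Finite.surjective_of_injective hinj p
  exact ⟨i, i.2, hi⟩

/-- The edge between the vertices `a i` and `a (i + 1)`. -/
lemma IsTraversal.exists_edge (ha : IsTraversal H fwd a) (i : ℕ) :
    ∃ p, p = (if fwd then a i else a (i + 1)) ∧
      H.edgeSet ℝ p = segment ℝ (H (a i)) (H (a (i + 1))) ∧
      ({p, finRotate k p} : Set (Fin k)) = {a i, a (i + 1)} := by
  have h := ha.succ i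
  cases fwd
  · have h' : finRotate k (a (i + 1)) = a i := by
      rw [h]
      exact (finRotate k).apply_symm_apply _
    refine ⟨a (i + 1), rfl, ?_, ?_⟩
    · rw [Polygon.edgeSet, affineSegment_eq_segment, h', segment_symm]
    · rw [h', Set.pair_comm]
  · have h' : finRotate k (a i) = a (i + 1) := by
      rw [h]
      rfl
    refine ⟨a i, rfl, ?_, ?_⟩
    · rw [Polygon.edgeSet, affineSegment_eq_segment, h']
    · rw [h']

lemma IsTraversal.boundary_eq (ha : IsTraversal H fwd a) (hk : 0 < k) :
    H.boundary ℝ = chainBoundary (fun i => H (a i)) (k - 1) := by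
  have hlast : k - 1 + 1 = k := by omega
  ext q
  simp only [Polygon.boundary, chainBoundary, Set.mem_iUnion, Set.mem_union, Set.mem_Iio,
    exists_prop]
  constructor
  · rintro ⟨p, hp⟩
    obtain ⟨i, hi, hip⟩ : ∃ i < k, p = if fwd then a i else a (i + 1) := by
      obtain ⟨i, hi, rfl⟩ := ha.surj p
      cases fwd
      · rcases Nat.eq_zero_or_pos i with rfl | h
        · exact ⟨k - 1, by omega, by simp [hlast, ha.period]⟩
        · exact ⟨i - 1, by omega, by simp [Nat.sub_add_cancel h]⟩
      · exact ⟨i, hi, rfl⟩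
    obtain ⟨p', hp', hedge, -⟩ := ha.exists_edge i
    rw [hip, ← hp', hedge] at hp
    rcases Nat.lt_or_ge i (k - 1) with h | h
    · exact Or.inl ⟨i, h, hp⟩
    · obtain rfl : i = k - 1 := by omega
      rw [hlast, ha.period, segment_symm] at hp
      exact Or.inr hp
  · rintro (⟨i, -, hq⟩ | hq)
    · obtain ⟨p, -, hedge, -⟩ := ha.exists_edge i
      exact ⟨p, hedge ▸ hq⟩
    · obtain ⟨p, -, hedge, -⟩ := ha.exists_edge (k - 1)
      rw [hlast, ha.period, segment_symm] at hedge
      exact ⟨p, hedge ▸ hq⟩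

lemma collinear_of_orient_eq_zero {σ : ℝ} (hσ : σ * σ = 1) {p q r : Plane} (hpq : p 0 < q 0)
    (h : orient σ p q r = 0) : Collinear ℝ {p, q, r} := by
  have hd : q 0 - p 0 ≠ 0 := by linarith
  have h' : (q 0 - p 0) * (r 1 - p 1) - (q 1 - p 1) * (r 0 - p 0) = 0 := by
    rcases mul_eq_zero.1 h with h | h
    · simp [h] at hσ
    · exact h
  rw [collinear_iff_of_mem (p₀ := p) (by simp)]
  refine ⟨q - p, ?_⟩
  rintro x (rfl | rfl | rfl)
  · exact ⟨0, by simp⟩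
  · exact ⟨1, by simp⟩
  · refine ⟨(x 0 - p 0) / (q 0 - p 0), ?_⟩
    ext l
    fin_cases l
    · simp
      field_simp
      ring
    · simp
      field_simp
      linarith

/-- The sign that makes the chain of a mountain lie above its base. -/
noncomputable def chainSign (H : Polygon Plane k) (a : ℕ → Fin k) : ℝ :=
  open Classical in if 0 < orient 1 (H (a 0)) (H (a (k - 1))) (H (a 1)) then 1 else -1

/-- The chain of a mountain lies on one side of its base, because its edges do not cross the
base. -/
lemma IsTraversal.isTerrain (ha : IsTraversal H fwd a) (hs : IsSimplePolygon H)
    (hg : InGeneralPosition H) : IsTerrain (chainSign H a) (fun i => H (a i)) (k - 1) := by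
  have hk := hs.three_le
  have hlast : k - 1 + 1 = k := by omega
  have hne : ∀ σ : ℝ, σ * σ = 1 → ∀ i j l, i < k → j < k → l < k → i < j → i ≠ l → j ≠ l →
      orient σ (H (a i)) (H (a j)) (H (a l)) ≠ 0 := by
    intro σ hσ i j l hi hj hl hij hil hjl h
    exact hg.not_collinear (a i) (a j) (a l) (fun e => hij.ne (ha.inj hi hj e))
      (fun e => hil (ha.inj hi hl e)) (fun e => hjl (ha.inj hj hl e))
      (collinear_of_orient_eq_zero hσ (ha.lt i j hij hj) h)
  set f : ℕ → ℝ := fun j => orient 1 (H (a 0)) (H (a (k - 1))) (H (a j)) with hf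
  have hf0 : ∀ j, 0 < j → j < k - 1 → f j ≠ 0 := fun j h1 h2 =>
    hne 1 (by norm_num) 0 (k - 1) j (by omega) (by omega) (by omega) (by omega) (by omega)
      (by omega)
  have x0n := ha.lt 0 (k - 1) (by omega) (by omega)
  have hstep : ∀ j, 0 < j → j + 1 < k - 1 → 0 < f j * f (j + 1) := by
    intro j h1 h2
    by_contra hc
    have hlt : f j * f (j + 1) < 0 :=
      lt_of_le_of_ne (not_lt.1 hc) (mul_ne_zero (hf0 j h1 (by omega)) (hf0 (j + 1) (by omega) h2))
    have hd : f (j + 1) - f j ≠ 0 := by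
      intro h
      rw [sub_eq_zero.1 h] at hlt
      exact absurd hlt (not_lt.2 (mul_self_nonneg _))
    -- the point where the edge from `a j` to `a (j + 1)` crosses the line of the base
    have hA : 0 ≤ f (j + 1) / (f (j + 1) - f j) := by
      have : f (j + 1) / (f (j + 1) - f j) =
          (f (j + 1) * f (j + 1) - f j * f (j + 1)) / (f (j + 1) - f j) ^ 2 := by
        field_simp
      rw [this]
      exact div_nonneg (by nlinarith [mul_self_nonneg (f (j + 1))]) (sq_nonneg _)
    have hB : 0 ≤ -f j / (f (j + 1) - f j) := by
      have : -f j / (f (j + 1) - f j) =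
          (f j * f j - f j * f (j + 1)) / (f (j + 1) - f j) ^ 2 := by
        field_simp
        ring
      rw [this]
      exact div_nonneg (by nlinarith [mul_self_nonneg (f j)]) (sq_nonneg _)
    have hAB : f (j + 1) / (f (j + 1) - f j) + -f j / (f (j + 1) - f j) = 1 := by
      field_simp
      ring
    set q : Plane := (f (j + 1) / (f (j + 1) - f j)) • H (a j) +
      (-f j / (f (j + 1) - f j)) • H (a (j + 1)) with hq
    have hq1 : q ∈ segment ℝ (H (a j)) (H (a (j + 1))) := ⟨_, _, hA, hB, hAB, rfl⟩
    have hqf : orient 1 (H (a 0)) (H (a (k - 1))) q = 0 := by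
      rw [hq, isAffineFun_orient 1 _ _ _ _ _ _ hAB]
      change f (j + 1) / (f (j + 1) - f j) * f j + -f j / (f (j + 1) - f j) * f (j + 1) = 0
      ring
    obtain ⟨h3, h4, -⟩ := (mem_segment_iff_orient (σ := 1) (by norm_num)
      (ha.lt j (j + 1) (by omega) (by omega))).1 hq1
    have hq2 : q ∈ segment ℝ (H (a 0)) (H (a (k - 1))) :=
      (mem_segment_iff_orient (σ := 1) (by norm_num) x0n).2
        ⟨(ha.lt 0 j h1 (by omega)).le.trans h3, h4.trans (ha.lt _ _ h2 (by omega)).le, hqf⟩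
    obtain ⟨p, -, hp, hp'⟩ := ha.exists_edge j
    obtain ⟨p', -, hr, hr'⟩ := ha.exists_edge (k - 1)
    rw [hlast, ha.period] at hr hr'
    rw [segment_symm] at hr
    have hdisj : ({p, finRotate k p} : Set (Fin k)) ∩ {p', finRotate k p'} = ∅ := by
      rw [hp', hr']
      ext x
      simp only [Set.mem_inter_iff, Set.mem_insert_iff, Set.mem_singleton_iff,
        Set.mem_empty_iff_false, iff_false, not_and]
      rintro (rfl | rfl) (h | h)
      all_goals
        have := ha.inj (by omega) (by omega) h
        omega
    have hpp : p ≠ p' := by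
      rintro rfl
      rw [Set.inter_self] at hdisj
      exact (Set.insert_nonempty _ _).ne_empty hdisj
    have hmem : q ∈ H.edgeSet ℝ p ∩ H.edgeSet ℝ p' := ⟨hp ▸ hq1, hr ▸ hq2⟩
    rw [hs.edge_inter p p' hpp, hdisj, Set.image_empty] at hmem
    exact hmem
  have hsame : ∀ j, 0 < j → j < k - 1 → 0 < f 1 * f j := by
    intro j h1
    induction j with
    | zero => omega
    | succ j ih =>
      intro h2
      rcases Nat.eq_zero_or_pos j with rfl | h
      · exact mul_self_pos.2 (hf0 1 h1 h2)
      · have h3 := ih h (by omega)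
        have h4 := hstep j h h2
        have h5 : 0 < (f 1 * f (j + 1)) * (f j * f j) := by nlinarith [mul_pos h3 h4]
        exact pos_of_mul_pos_left h5 (mul_self_nonneg _)
  have hσ : chainSign H a * chainSign H a = 1 := by
    unfold chainSign
    split_ifs <;> norm_num
  refine ⟨hσ, by omega, fun i j hij hj => ha.lt i j hij (by omega), fun i j l hij hjl hl =>
    hne _ hσ i j l (by omega) (by omega) (by omega) hij (by omega) (by omega), fun j h1 h2 => ?_⟩
  have h3 : orient (chainSign H a) (H (a 0)) (H (a (k - 1))) (H (a j)) = chainSign H a * f j := by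
    simp only [hf, orient]
    ring
  have h4 := hsame j h1 h2
  rw [h3, chainSign]
  split_ifs with h
  · rw [one_mul]
    exact pos_of_mul_pos_right h4 h.le
  · have h5 : f 1 ≤ 0 := not_lt.1 h
    by_contra hc
    nlinarith

/-- The triangles of the fan, translated into sets of vertices of the polygon, form a
triangulation. -/
lemma IsTraversal.outputsTriangulation (ha : IsTraversal H fwd a) (hs : IsSimplePolygon H)
    (hg : InGeneralPosition H) {L R : ℕ → ℕ}
    (hf : IsFan (chainSign H a) (fun i => H (a i)) (k - 1) L R) :
    OutputsTriangulation H
      ((List.range' 1 (k - 2)).map fun j => (a (L j), a j, a (R j))) := by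
  have hk := hs.three_le
  have hv := ha.isTerrain hs hg
  have hb := hv.isBase (L := L)
  set v : ℕ → Plane := fun i => H (a i)
  have hout : outputTriangles ((List.range' 1 (k - 2)).map fun j => (a (L j), a j, a (R j))) =
      (List.range' 1 (k - 2)).map fun j => (fanTriangle L R j).image a := by
    simp [outputTriangles, fanTriangle, Finset.image_insert, Function.comp_def]
  have hrange : ∀ j, j ∈ List.range' 1 (k - 2) ↔ 0 < j ∧ j < k - 1 := by
    intro j
    rw [List.mem_range'_1]
    omega
  have hmem : ∀ t, t ∈ (List.range' 1 (k - 2)).map (fun j => (fanTriangle L R j).image a) ↔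
      ∃ j, 0 < j ∧ j < k - 1 ∧ t = (fanTriangle L R j).image a := by
    intro t
    simp only [List.mem_map, hrange, and_assoc, eq_comm]
  have hlt : ∀ j, 0 < j → j < k - 1 → L j < j ∧ j < R j ∧ R j < k := fun j h1 h2 =>
    ⟨(hf.left j h1 h2).1, (hf.right j h1 h2).1, by have := hf.le j h1 h2; omega⟩
  have hbd : ∀ j, 0 < j → j < k - 1 → ∀ m ∈ fanTriangle L R j, m < k := by
    intro j h1 h2 m hm
    have := (hb.fanTriangle_subset hv hf h1 h2 hm).2
    omega
  have hinj : Set.InjOn a (Set.Iio k) := fun i hi j hj h => ha.inj hi hj h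
  have hhull : ∀ t : Finset ℕ, vertexHull H (t.image a) = convexHull ℝ (v '' t) := by
    intro t
    rw [vertexHull, Finset.coe_image, Set.image_image]
  have hcard : ∀ j, 0 < j → j < k - 1 → ((fanTriangle L R j).image a).card = 3 := by
    intro j h1 h2
    obtain ⟨h3, h4, h5⟩ := hlt j h1 h2
    rw [Finset.card_image_of_injOn (hinj.mono fun m hm => hbd j h1 h2 m hm)]
    exact Finset.card_eq_three.2 ⟨_, _, _, by omega, by omega, by omega, rfl⟩
  rw [OutputsTriangulation, hout]
  refine ⟨?_, ?_, ?_, ?_, ?_⟩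
  · refine List.Nodup.map_on ?_ (List.nodup_range' (s := 1) (n := k - 2))
    intro j hj j' hj' he
    obtain ⟨h1, h2⟩ := (hrange j).1 hj
    obtain ⟨h3, h4⟩ := (hrange j').1 hj'
    have hsub : ∀ m ∈ fanTriangle L R j, m ∈ fanTriangle L R j' := by
      intro m hm
      have hm' : a m ∈ (fanTriangle L R j').image a := he ▸ Finset.mem_image_of_mem a hm
      obtain ⟨m', h5, h6⟩ := Finset.mem_image.1 hm'
      rwa [← ha.inj (hbd j' h3 h4 m' h5) (hbd j h1 h2 m hm) h6]
    have e1 := hsub (L j) (by simp [fanTriangle])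
    have e2 := hsub j (by simp [fanTriangle])
    have e3 := hsub (R j) (by simp [fanTriangle])
    simp only [fanTriangle, Finset.mem_insert, Finset.mem_singleton] at e1 e2 e3
    have := hlt j h1 h2
    have := hlt j' h3 h4
    omega
  · intro t ht
    obtain ⟨j, h1, h2, rfl⟩ := (hmem t).1 ht
    exact hcard j h1 h2
  · intro t ht
    obtain ⟨j, h1, h2, rfl⟩ := (hmem t).1 ht
    obtain ⟨h3, h4, h5⟩ := hlt j h1 h2
    have e : ((fanTriangle L R j).image a : Finset (Fin k)) ≃ Fin 3 :=
      Finset.equivFinOfCardEq (hcard j h1 h2)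
    rw [← affineIndependent_equiv e.symm, affineIndependent_iff_not_collinear,
      EquivLike.range_comp (fun i : ((fanTriangle L R j).image a : Finset (Fin k)) => H i) e.symm]
    have hr : Set.range (fun i : ((fanTriangle L R j).image a : Finset (Fin k)) => H i) =
        {H (a (L j)), H (a j), H (a (R j))} := by
      ext x
      simp [fanTriangle, eq_comm]
    rw [hr]
    exact hg.not_collinear _ _ _ (fun h => by have := ha.inj (by omega) (by omega) h; omega)
      (fun h => by have := ha.inj (by omega) (by omega) h; omega)
      (fun h => by have := ha.inj (by omega) (by omega) h; omega)
  · have hreg : polygonRegion H = chainRegion (chainSign H a) v (k - 1) 0 (k - 1) := by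
      rw [← hv.region_eq hf, polygonRegion, ha.boundary_eq (by omega)]
    rw [hreg, hb.chainRegion_eq_iUnion hv hf (by omega)]
    ext q
    simp only [Set.mem_iUnion, exists_prop, Set.mem_ofPred_eq, hmem, Set.mem_Ioo]
    constructor
    · rintro ⟨_, ⟨j, h1, h2, rfl⟩, hq⟩
      exact ⟨j, ⟨h1, h2⟩, hhull _ ▸ hq⟩
    · rintro ⟨j, ⟨h1, h2⟩, hq⟩
      exact ⟨_, ⟨j, h1, h2, rfl⟩, (hhull _).symm ▸ hq⟩
  · intro t ht t' ht'
    obtain ⟨j, h1, h2, rfl⟩ := (hmem t).1 ht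
    obtain ⟨j', h3, h4, rfl⟩ := (hmem t').1 ht'
    have e : (fanTriangle L R j).image a ∩ (fanTriangle L R j').image a =
        (fanTriangle L R j ∩ fanTriangle L R j').image a := by
      refine (Finset.image_inter_of_injOn _ _ (hinj.mono ?_)).symm
      rintro m (hm | hm)
      · exact hbd j h1 h2 m hm
      · exact hbd j' h3 h4 m hm
    rw [e, hhull, hhull, hhull]
    refine Set.Subset.antisymm (hb.inter_subset hv hf j j' h1 h2 h3 h4)
      (Set.subset_inter (convexHull_mono (Set.image_mono ?_)) (convexHull_mono (Set.image_mono ?_)))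
    · exact_mod_cast Finset.inter_subset_left
    · exact_mod_cast Finset.inter_subset_right

end Traversal

/-! ### Total correctness with a time bound -/

section Terminates

variable {k m n : ℕ}

/-- Started with the work-space `s`, the program halts after at most `N` steps, and its outputs and
the final work-space satisfy `Q`. -/
def Terminates (H : Polygon Plane k) (S : Program m n) (s : WorkSpace k m n) (N : ℕ)
    (Q : List (Fin k × Fin k × Fin k) → WorkSpace k m n → Prop) : Prop :=
  ∃ t out s', Runs H S s t out s' ∧ t ≤ N ∧ Q out s'

variable {H : Polygon Plane k} {S S' : Program m n} {s : WorkSpace k m n} {N N' : ℕ}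
  {b : Test m n} {Q Q' : List (Fin k × Fin k × Fin k) → WorkSpace k m n → Prop}

lemma Terminates.mono (h : Terminates H S s N Q) (hN : N ≤ N') (hQ : ∀ o s', Q o s' → Q' o s') :
    Terminates H S s N' Q' := by
  obtain ⟨t, o, s', h1, h2, h3⟩ := h
  exact ⟨t, o, s', h1, h2.trans hN, hQ _ _ h3⟩

lemma Terminates.skip (h : Q [] s) : Terminates H .skip s 1 Q :=
  ⟨_, _, _, .skip s, le_rfl, h⟩

lemma Terminates.copy {p q : Fin m} (h : Q [] ⟨Function.update s.ptr p (s.ptr q), s.coord⟩) :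
    Terminates H (.copy p q) s 1 Q :=
  ⟨_, _, _, .copy p q s, le_rfl, h⟩

lemma Terminates.loadX {c : Fin n} {p : Fin m}
    (h : Q [] ⟨s.ptr, Function.update s.coord c (H (s.ptr p) 0)⟩) :
    Terminates H (.loadX c p) s 1 Q :=
  ⟨_, _, _, .loadX c p s, le_rfl, h⟩

lemma Terminates.output {p q r : Fin m} (h : Q [(s.ptr p, s.ptr q, s.ptr r)] s) :
    Terminates H (.output p q r) s 1 Q :=
  ⟨_, _, _, .output p q r s, le_rfl, h⟩

lemma Terminates.seq (h : Terminates H S s N fun o s' =>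
    Terminates H S' s' N' fun o' s'' => Q (o ++ o') s'') :
    Terminates H (.seq S S') s (N + N') Q := by
  obtain ⟨t, o, s', h1, h2, t', o', s'', h3, h4, h5⟩ := h
  exact ⟨_, _, _, .seq h1 h3, by omega, h5⟩

lemma Terminates.ite (h : b.Holds H s → Terminates H S s N Q)
    (h' : ¬ b.Holds H s → Terminates H S' s N Q) :
    Terminates H (.ite b S S') s (b.cost + N) Q := by
  by_cases hb : b.Holds H s
  · obtain ⟨t, o, s', h1, h2, h3⟩ := h hb
    exact ⟨_, _, _, .ite_true hb h1, by omega, h3⟩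
  · obtain ⟨t, o, s', h1, h2, h3⟩ := h' hb
    exact ⟨_, _, _, .ite_false hb h1, by omega, h3⟩

/-- The rule for loops: the invariant speaks of a bound for the number of remaining iterations, of
the outputs so far, and of the work-space. -/
lemma Terminates.while (Inv : ℕ → List (Fin k × Fin k × Fin k) → WorkSpace k m n → Prop)
    (h : ∀ d o s, Inv d o s → b.Holds H s →
      ∃ d', d = d' + 1 ∧ Terminates H S s N fun o' s' => Inv d' (o ++ o') s') :
    ∀ d o s, Inv d o s → Terminates H (.while b S) s (d * (b.cost + N) + b.cost)
      fun o' s' => (∃ d', Inv d' (o ++ o') s') ∧ ¬ b.Holds H s' := by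
  intro d
  induction d with
  | zero =>
    intro o s hs
    by_cases hb : b.Holds H s
    · obtain ⟨d', hd', -⟩ := h _ _ _ hs hb
      omega
    · exact ⟨_, _, _, .while_false hb, by omega, ⟨0, by simpa using hs⟩, hb⟩
  | succ d ih =>
    intro o s hs
    by_cases hb : b.Holds H s
    · obtain ⟨d', hd', t, o', s', h1, h2, h3⟩ := h _ _ _ hs hb
      obtain rfl : d = d' := by omega
      obtain ⟨t', o'', s'', h4, h5, h6, h7⟩ := ih _ _ h3
      refine ⟨_, _, _, .while_true hb h1 h4, ?_, ?_, h7⟩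
      · rw [Nat.succ_mul]
        omega
      · rwa [← List.append_assoc]
    · exact ⟨_, _, _, .while_false hb, by omega, ⟨d + 1, by simpa using hs⟩, hb⟩

end Terminates

/-! ### The program

The pointer words hold: `0` the leftmost vertex, `1` the rightmost vertex, `2` the middle vertex of
the current triangle, `3` and `5` its left and right vertices, `4` the position of the scan to the
left. While the leftmost vertex is being searched, `2` and `3` hold the neighbours of the
candidate, and the coordinate words hold the abscissas of the candidate and of these
neighbours. -/

/-- Move a pointer one step in the stored direction, or against it. -/
def stepPtr (fwd : Bool) (p : Fin 6) : Program 6 3 :=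
  if fwd then .next p else .prev p

/-- Is the vertex `r` below the line through `p` and `q`, where `p` is to the left of `q`? If `up`
is false, the roles of "below" and "above" are exchanged. -/
def belowTest (up : Bool) (p q r : Fin 6) : Test 6 3 :=
  if up then .leftOf q p r else .leftOf p q r

/-- Load the abscissas of the candidate for the leftmost vertex and of its two neighbours. -/
def probe : Program 6 3 :=
  .seq (.copy 2 0) <| .seq (.next 2) <| .seq (.copy 3 0) <| .seq (.prev 3) <|
    .seq (.loadX 0 0) <| .seq (.loadX 1 2) (.loadX 2 3)

/-- Walk to the vertex that is to the left of both its neighbours. -/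
def findLeftmost : Program 6 3 :=
  .seq probe <| .while (.not (.and (.coordLT 0 1) (.coordLT 0 2))) (.seq (.next 0) probe)

/-- Find the left vertex of the current triangle. -/
def scanLeft (fwd up : Bool) : Program 6 3 :=
  .seq (.copy 3 2) <| .seq (stepPtr (!fwd) 3) <| .seq (.copy 4 3) <|
    .while (.not (.samePtr 4 0)) <|
      .seq (stepPtr (!fwd) 4) (.ite (belowTest up 3 2 4) (.copy 3 4) .skip)

/-- Find the right vertex of the current triangle. -/
def scanRight (fwd up : Bool) : Program 6 3 :=
  .seq (.copy 5 2) <| .seq (stepPtr fwd 5) <|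
    .while (.not (belowTest up 3 2 5)) (stepPtr fwd 5)

/-- Output the triangle of every vertex from the current one to the last but one. -/
def outputTrianglesProgram (fwd up : Bool) : Program 6 3 :=
  .while (.not (.samePtr 2 1)) <|
    .seq (scanLeft fwd up) <| .seq (scanRight fwd up) <| .seq (.output 3 2 5) (stepPtr fwd 2)

/-- Triangulate the mountain, given its leftmost vertex and the direction of the chain. -/
def triangulateFrom (fwd : Bool) : Program 6 3 :=
  .seq (.copy 1 0) <| .seq (stepPtr (!fwd) 1) <| .seq (.copy 2 0) <| .seq (stepPtr fwd 2) <|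
    .ite (.leftOf 0 1 2) (outputTrianglesProgram fwd true) (outputTrianglesProgram fwd false)

/-- Triangulate a mountain. -/
def triangulateMountain : Program 6 3 :=
  .seq findLeftmost (.ite (.coordLT 1 2) (triangulateFrom true) (triangulateFrom false))

/-! ### Correctness of the program -/

section Correctness

variable {k : ℕ} {H : Polygon Plane k} {fwd up : Bool} {a : ℕ → Fin k} {s : WorkSpace k 6 3}

lemma Terminates.stepPtr {p : Fin 6} {Q : List (Fin k × Fin k × Fin k) → WorkSpace k 6 3 → Prop}
    (h : Q [] ⟨Function.update s.ptr p (stepPerm k fwd (s.ptr p)), s.coord⟩) :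
    Terminates H (stepPtr fwd p) s 1 Q := by
  cases fwd
  · exact ⟨_, _, _, .prev p s, le_rfl, h⟩
  · exact ⟨_, _, _, .next p s, le_rfl, h⟩

lemma IsTraversal.pred (ha : IsTraversal H fwd a) (i : ℕ) :
    stepPerm k (!fwd) (a (i + 1)) = a i := by
  rw [ha.succ]
  cases fwd
  · exact (finRotate k).apply_symm_apply _
  · exact (finRotate k).symm_apply_apply _

lemma IsTraversal.pred_zero (ha : IsTraversal H fwd a) (hk : 0 < k) :
    stepPerm k (!fwd) (a 0) = a (k - 1) := by
  obtain ⟨n, rfl⟩ : ∃ n, k = n + 1 := ⟨k - 1, by omega⟩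
  rw [← ha.period, ha.pred]
  rfl

lemma belowTest_cost (up : Bool) (p q r : Fin 6) : (belowTest up p q r).cost = 1 := by
  cases up <;> rfl

lemma belowTest_holds (up : Bool) (p q r : Fin 6) :
    (belowTest up p q r).Holds H s ↔
      orient (if up then 1 else -1) (H (s.ptr p)) (H (s.ptr q)) (H (s.ptr r)) < 0 := by
  cases up
  · simp only [belowTest, Test.Holds, orient, Bool.false_eq_true, if_false]
    constructor <;> intro h <;> linarith
  · simp only [belowTest, Test.Holds, orient, if_true]
    constructor <;> intro h <;> linarith

/-- The work-space while the triangle of the vertex `a j` is computed. -/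
structure AtVertex (a : ℕ → Fin k) (j : ℕ) (s : WorkSpace k 6 3) : Prop where
  first : s.ptr 0 = a 0
  last : s.ptr 1 = a (k - 1)
  middle : s.ptr 2 = a j

lemma scanLeft_terminates (ha : IsTraversal H fwd a)
    (hv : IsTerrain (if up then 1 else -1) (fun i => H (a i)) (k - 1)) {j : ℕ} (h0 : 0 < j)
    (hj : j < k - 1) (hs : AtVertex a j s) :
    Terminates H (scanLeft fwd up) s (6 * k + 5) fun o s' => o = [] ∧ AtVertex a j s' ∧
      ∃ l, IsLeft (if up then 1 else -1) (fun i => H (a i)) j l ∧ s'.ptr 3 = a l := by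
  set σ : ℝ := if up then 1 else -1 with hσ
  set v : ℕ → Plane := fun i => H (a i)
  obtain ⟨i, rfl⟩ : ∃ i, j = i + 1 := ⟨j - 1, by omega⟩
  -- the vertex in word `3` has the largest slope to `a j` among those scanned
  let Inv : ℕ → List (Fin k × Fin k × Fin k) → WorkSpace k 6 3 → Prop := fun d o s =>
    o = [] ∧ AtVertex a (i + 1) s ∧ s.ptr 4 = a d ∧ ∃ l, s.ptr 3 = a l ∧ d ≤ l ∧ l < i + 1 ∧
      ∀ m, d ≤ m → m < i + 1 → 0 ≤ orient σ (v l) (v (i + 1)) (v m)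
  have hloop := Terminates.while (H := H) (b := .not (.samePtr 4 0))
    (S := .seq (stepPtr (!fwd) 4) (.ite (belowTest up 3 2 4) (.copy 3 4) .skip)) (N := 3) Inv (by
    rintro d o s ⟨rfl, h1, h2, l, h3, h4, h5, h6⟩ hb
    obtain ⟨d, rfl⟩ : ∃ d', d = d' + 1 := by
      refine ⟨d - 1, ?_⟩
      rcases Nat.eq_zero_or_pos d with rfl | h
      · exact absurd (h2.trans h1.first.symm) hb
      · omega
    refine ⟨d, rfl, ?_⟩
    have hstep : stepPerm k (!fwd) (s.ptr 4) = a d := by rw [h2, ha.pred]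
    refine Terminates.seq (N := 1) (N' := 2) (Terminates.stepPtr ?_)
    rw [hstep]
    refine (Terminates.ite (N := 1) (fun hb => Terminates.copy ?_)
      fun hb => Terminates.skip ?_).mono (by rw [belowTest_cost]) fun _ _ h => h
    all_goals
      rw [belowTest_holds] at hb
      simp only [Function.update_apply, Fin.reduceEq, if_true, if_false, h3, h1.middle] at hb
    · refine ⟨rfl, ⟨?_, ?_, ?_⟩, ?_, d, ?_, le_rfl, by omega, fun m h7 h8 => ?_⟩
      · simpa [Function.update_apply] using h1.first
      · simpa [Function.update_apply] using h1.last
      · simpa [Function.update_apply] using h1.middle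
      · simp
      · simp
      · rcases h7.eq_or_lt with rfl | h7
        · rw [orient_self_left]
        · exact hv.orient_nonneg_of_below (by omega) h5 hj.le hb h8 (h6 m h7 h8)
    · refine ⟨rfl, ⟨?_, ?_, ?_⟩, ?_, l, ?_, by omega, h5, fun m h7 h8 => ?_⟩
      · simpa [Function.update_apply] using h1.first
      · simpa [Function.update_apply] using h1.last
      · simpa [Function.update_apply] using h1.middle
      · simp
      · simpa [Function.update_apply] using h3
      · rcases h7.eq_or_lt with rfl | h7
        · exact not_lt.1 hb
        · exact h6 m h7 h8)
  refine Terminates.mono (N := 1 + (1 + (1 + (i * (2 + 3) + 2)))) ?_ (by omega) fun _ _ h => h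
  refine Terminates.seq (Terminates.copy (Terminates.seq (Terminates.stepPtr
    (Terminates.seq (Terminates.copy ?_)))))
  refine (hloop i [] _ ⟨rfl, ⟨?_, ?_, ?_⟩, ?_, i, ?_, le_rfl, by omega, ?_⟩).mono
    le_rfl ?_
  · simpa [Function.update_apply] using hs.first
  · simpa [Function.update_apply] using hs.last
  · simpa [Function.update_apply] using hs.middle
  · simp [hs.middle, ha.pred]
  · simp [hs.middle, ha.pred]
  · intro m h1 h2
    obtain rfl : m = i := by omega
    rw [orient_self_left]
  · rintro o s' ⟨⟨d, h0, h1, h2, l, h3, h4, h5, h6⟩, hb⟩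
    have hd : d = 0 := by
      have : s'.ptr 4 = s'.ptr 0 := not_not.1 hb
      rw [h2, h1.first] at this
      exact ha.inj (by omega) (by omega) this
    subst hd
    exact ⟨by simpa using h0, h1, l, ⟨h5, fun m hm => h6 m (Nat.zero_le m) hm⟩, h3⟩

lemma scanRight_terminates (ha : IsTraversal H fwd a)
    (hv : IsTerrain (if up then 1 else -1) (fun i => H (a i)) (k - 1)) {j l : ℕ} (h0 : 0 < j)
    (hj : j < k - 1) (hs : AtVertex a j s) (hs3 : s.ptr 3 = a l)
    (hl : IsLeft (if up then 1 else -1) (fun i => H (a i)) j l) :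
    Terminates H (scanRight fwd up) s (3 * k + 4) fun o s' => o = [] ∧ AtVertex a j s' ∧
      s'.ptr 3 = a l ∧
      ∃ r, r ≤ k - 1 ∧ IsRight (if up then 1 else -1) (fun i => H (a i)) l j r ∧
        s'.ptr 5 = a r := by
  have hlast := (hv.isBase (L := fun _ => 0)).orient_neg hv h0 hj hl
  set σ : ℝ := if up then 1 else -1 with hσ
  set v : ℕ → Plane := fun i => H (a i)
  let Inv : ℕ → List (Fin k × Fin k × Fin k) → WorkSpace k 6 3 → Prop := fun d o s =>
    o = [] ∧ AtVertex a j s ∧ s.ptr 3 = a l ∧ ∃ r, s.ptr 5 = a r ∧ r + d = k - 1 ∧ j < r ∧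
      ∀ m, j < m → m < r → 0 ≤ orient σ (v l) (v j) (v m)
  have hloop := Terminates.while (H := H) (b := .not (belowTest up 3 2 5))
    (S := stepPtr fwd 5) (N := 1) Inv (by
    rintro d o s ⟨rfl, h1, h2, r, h3, h4, h5, h6⟩ hb
    have hb' : ¬ orient σ (v l) (v j) (v r) < 0 := by
      have := mt (belowTest_holds (H := H) up 3 2 5).2 hb
      rwa [h1.middle, h2, h3] at this
    -- the scan stops at the last vertex at the latest
    obtain ⟨d, rfl⟩ : ∃ d', d = d' + 1 := by
      refine ⟨d - 1, ?_⟩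
      rcases Nat.eq_zero_or_pos d with rfl | h
      · obtain rfl : r = k - 1 := by omega
        exact absurd hlast hb'
      · omega
    refine ⟨d, rfl, Terminates.stepPtr ⟨rfl, ⟨?_, ?_, ?_⟩, ?_, r + 1, ?_, by omega, by omega,
      fun m h7 h8 => ?_⟩⟩
    · simpa [Function.update_apply] using h1.first
    · simpa [Function.update_apply] using h1.last
    · simpa [Function.update_apply] using h1.middle
    · simpa [Function.update_apply] using h2
    · simp [h3, ha.succ]
    · rcases (Nat.lt_succ_iff.1 h8).eq_or_lt with rfl | h8
      · exact not_lt.1 hb'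
      · exact h6 m h7 h8)
  rw [show (Test.not (belowTest up 3 2 5)).cost = 2 by simp [Test.cost, belowTest_cost]] at hloop
  refine Terminates.mono (N := 1 + (1 + ((k - 1 - (j + 1)) * (2 + 1) + 2))) ?_ (by omega)
    fun _ _ h => h
  refine Terminates.seq (Terminates.copy (Terminates.seq (Terminates.stepPtr ?_)))
  refine (hloop _ [] _ ⟨rfl, ⟨?_, ?_, ?_⟩, ?_, j + 1, ?_, by omega, by omega, ?_⟩).mono
    le_rfl ?_
  · simpa [Function.update_apply] using hs.first
  · simpa [Function.update_apply] using hs.last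
  · simpa [Function.update_apply] using hs.middle
  · simpa [Function.update_apply] using hs3
  · simp [hs.middle, ha.succ]
  · intro m h1 h2
    omega
  · rintro o s' ⟨⟨d, h0, h1, h2, r, h3, h4, h5, h6⟩, hb⟩
    have hb' : orient σ (v l) (v j) (v r) < 0 := by
      have := (belowTest_holds (H := H) up 3 2 5).1 (not_not.1 hb)
      rwa [h1.middle, h2, h3] at this
    exact ⟨by simpa using h0, h1, h2, r, by omega, ⟨h5, hb', h6⟩, h3⟩

lemma outputTrianglesProgram_terminates (ha : IsTraversal H fwd a) (hk : 3 ≤ k)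
    (hv : IsTerrain (if up then 1 else -1) (fun i => H (a i)) (k - 1)) (hs : AtVertex a 1 s) :
    Terminates H (outputTrianglesProgram fwd up) s (k * (9 * k + 13) + 2) fun o _ =>
      ∃ L R, IsFan (if up then 1 else -1) (fun i => H (a i)) (k - 1) L R ∧
        o = (List.range' 1 (k - 2)).map fun j => (a (L j), a j, a (R j)) := by
  set σ : ℝ := if up then 1 else -1 with hσ
  set v : ℕ → Plane := fun i => H (a i)
  let Inv : ℕ → List (Fin k × Fin k × Fin k) → WorkSpace k 6 3 → Prop := fun d o s =>
    ∃ i, AtVertex a (i + 1) s ∧ i + 1 + d = k - 1 ∧ ∃ L R : ℕ → ℕ,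
      (∀ j, 0 < j → j < i + 1 → IsLeft σ v j (L j) ∧ IsRight σ v (L j) j (R j) ∧ R j ≤ k - 1) ∧
      o = (List.range' 1 i).map fun j => (a (L j), a j, a (R j))
  have hloop := Terminates.while (H := H) (b := .not (.samePtr 2 1))
    (S := .seq (scanLeft fwd up) <| .seq (scanRight fwd up) <|
      .seq (.output 3 2 5) (stepPtr fwd 2)) (N := 9 * k + 11) Inv (by
    rintro d o s ⟨i, h1, h2, L, R, h3, rfl⟩ hb
    obtain ⟨d, rfl⟩ : ∃ d', d = d' + 1 := by
      refine ⟨d - 1, ?_⟩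
      rcases Nat.eq_zero_or_pos d with rfl | h
      · refine absurd (h1.middle.trans ?_) hb
        rw [h1.last, ← h2]
      · omega
    refine ⟨d, rfl, ?_⟩
    refine Terminates.mono (N := (6 * k + 5) + ((3 * k + 4) + (1 + 1))) ?_ (by omega)
      fun _ _ h => h
    refine Terminates.seq ((scanLeft_terminates ha hv (Nat.succ_pos i) (by omega) h1).mono
      le_rfl ?_)
    rintro _ s1 ⟨rfl, h4, l, h5, h6⟩
    refine Terminates.seq ((scanRight_terminates ha hv (Nat.succ_pos i) (by omega) h4 h6 h5).mono
      le_rfl ?_)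
    rintro _ s2 ⟨rfl, h7, h8, r, h9, h10, h11⟩
    refine Terminates.seq (Terminates.output (Terminates.stepPtr ?_))
    refine ⟨i + 1, ⟨?_, ?_, ?_⟩, by omega, Function.update L (i + 1) l,
      Function.update R (i + 1) r, fun j h12 h13 => ?_, ?_⟩
    · simpa [Function.update_apply] using h7.first
    · simpa [Function.update_apply] using h7.last
    · simp [h7.middle, ha.succ]
    · rcases (Nat.lt_succ_iff.1 h13).eq_or_lt with rfl | h13
      · simp only [Function.update_self]
        exact ⟨h5, h10, h9⟩
      · simp only [Function.update_of_ne h13.ne]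
        exact h3 j h12 h13
    · rw [List.range'_1_concat, List.map_append]
      simp only [List.nil_append, List.append_nil]
      congr 1
      · refine List.map_congr_left fun j hj => ?_
        have hne : j ≠ i + 1 := by
          rw [List.mem_range'_1] at hj
          omega
        simp only [Function.update_of_ne hne]
      · simp [h7.middle, h8, h11, add_comm 1 i])
  refine (hloop (k - 2) [] s ⟨0, hs, by omega, fun j => j, fun j => j, ?_, rfl⟩).mono ?_ ?_
  · intros
    omega
  · change (k - 2) * (2 + (9 * k + 11)) + 2 ≤ _
    have := Nat.mul_le_mul_right (9 * k + 13) (Nat.sub_le k 2)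
    linarith
  · rintro o s' ⟨⟨d, i, h1, h2, L, R, h3, h4⟩, hb⟩
    have hi : i + 1 = k - 1 := by
      have : s'.ptr 2 = s'.ptr 1 := not_not.1 hb
      rw [h1.middle, h1.last] at this
      exact ha.inj (by omega) (by omega) this
    rw [hi] at h3
    obtain rfl : i = k - 2 := by omega
    exact ⟨L, R, ⟨fun j h h' => (h3 j h h').1, fun j h h' => (h3 j h h').2.1,
      fun j h h' => (h3 j h h').2.2⟩, by simpa using h4⟩

lemma triangulateFrom_terminates (ha : IsTraversal H fwd a) (hS : IsSimplePolygon H)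
    (hg : InGeneralPosition H) (hs : s.ptr 0 = a 0) :
    Terminates H (triangulateFrom fwd) s (k * (9 * k + 13) + 7) fun o _ =>
      OutputsTriangulation H o := by
  have hk := hS.three_le
  have hv := ha.isTerrain hS hg
  refine Terminates.mono (N := 1 + (1 + (1 + (1 + (1 + (k * (9 * k + 13) + 2)))))) ?_ (by omega)
    fun _ _ h => h
  refine Terminates.seq (Terminates.copy (Terminates.seq (Terminates.stepPtr
    (Terminates.seq (Terminates.copy (Terminates.seq (Terminates.stepPtr ?_)))))))
  have e0 : stepPerm k fwd (a 0) = a 1 := (ha.succ 0).symm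
  have e1 := ha.pred_zero (by omega)
  set s' : WorkSpace k 6 3 := ⟨_, _⟩ with hs'
  have hat : AtVertex a 1 s' := by
    refine ⟨?_, ?_, ?_⟩
    · simp [hs', hs]
    · simp [hs', hs, e1]
    · simp [hs', hs, e0]
  have hsign : (Test.leftOf 0 1 2 : Test 6 3).Holds H s' ↔
      0 < orient 1 (H (a 0)) (H (a (k - 1))) (H (a 1)) := by
    simp only [Test.Holds, hat.first, hat.last, hat.middle, orient, one_mul]
  refine Terminates.ite (fun hb => ?_) fun hb => ?_
  · have e : chainSign H a = if true then 1 else -1 := by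
      rw [chainSign, if_pos (hsign.1 hb)]
      rfl
    refine (outputTrianglesProgram_terminates ha hk (e ▸ hv) hat).mono le_rfl ?_
    rintro o - ⟨L, R, hf, rfl⟩
    exact ha.outputsTriangulation hS hg (e ▸ hf)
  · have e : chainSign H a = if false then 1 else -1 := by
      rw [chainSign, if_neg (mt hsign.2 hb)]
      rfl
    refine (outputTrianglesProgram_terminates ha hk (e ▸ hv) hat).mono le_rfl ?_
    rintro o - ⟨L, R, hf, rfl⟩
    exact ha.outputsTriangulation hS hg (e ▸ hf)

/-- The coordinate words hold the abscissas of the vertex in word `0` and of its neighbours. -/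
structure IsProbed (H : Polygon Plane k) (s : WorkSpace k 6 3) : Prop where
  self : s.coord 0 = H (s.ptr 0) 0
  next : s.coord 1 = H (finRotate k (s.ptr 0)) 0
  prev : s.coord 2 = H ((finRotate k).symm (s.ptr 0)) 0

lemma probe_terminates (s : WorkSpace k 6 3) :
    Terminates H probe s 7 fun o s' => o = [] ∧ s'.ptr 0 = s.ptr 0 ∧ IsProbed H s' := by
  refine Terminates.seq (N := 1) (N' := 6) (Terminates.copy ?_)
  refine Terminates.seq (N := 1) (N' := 5) (Terminates.stepPtr (fwd := true) ?_)
  refine Terminates.seq (N := 1) (N' := 4) (Terminates.copy ?_)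
  refine Terminates.seq (N := 1) (N' := 3) (Terminates.stepPtr (fwd := false) ?_)
  refine Terminates.seq (N := 1) (N' := 2) (Terminates.loadX ?_)
  refine Terminates.seq (N := 1) (N' := 1) (Terminates.loadX (Terminates.loadX ?_))
  refine ⟨rfl, ?_, ?_, ?_, ?_⟩ <;> simp [stepPerm]

/-- The leftmost vertex is the only one that is to the left of both its neighbours. -/
lemma IsTraversal.isLeftmost_iff (ha : IsTraversal H fwd a) (hk : 3 ≤ k) (p : Fin k) :
    (H p 0 < H (finRotate k p) 0 ∧ H p 0 < H ((finRotate k).symm p) 0) ↔ p = a 0 := by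
  have h : (H p 0 < H (stepPerm k fwd p) 0 ∧ H p 0 < H (stepPerm k (!fwd) p) 0) ↔ p = a 0 := by
    constructor
    · rintro ⟨-, h⟩
      obtain ⟨i, hi, rfl⟩ := ha.surj p
      rcases Nat.eq_zero_or_pos i with rfl | h0
      · rfl
      · obtain ⟨i, rfl⟩ : ∃ j, i = j + 1 := ⟨i - 1, by omega⟩
        rw [ha.pred] at h
        exact absurd h (not_lt.2 (ha.lt i (i + 1) (by omega) hi).le)
    · rintro rfl
      rw [← ha.succ, ha.pred_zero (by omega)]
      exact ⟨ha.lt 0 1 (by omega) (by omega), ha.lt 0 (k - 1) (by omega) (by omega)⟩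
  rw [← h]
  cases fwd
  · exact and_comm
  · exact Iff.rfl

lemma IsTraversal.exists_iterate (ha : IsTraversal H fwd a) (p : Fin k) :
    ∃ d ≤ k, (finRotate k)^[d] p = a 0 := by
  obtain ⟨i, hi, rfl⟩ := ha.surj p
  cases fwd
  · refine ⟨i, hi.le, ?_⟩
    clear hi
    induction i with
    | zero => rfl
    | succ i ih =>
      rw [Function.iterate_succ_apply]
      exact (congrArg _ (ha.pred i)).trans ih
  · refine ⟨k - i, Nat.sub_le k i, ?_⟩
    have : ∀ d, (finRotate k)^[d] (a i) = a (i + d) := by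
      intro d
      induction d with
      | zero => rfl
      | succ d ih =>
        rw [Function.iterate_succ_apply', ih]
        exact (ha.succ (i + d)).symm
    rw [this, Nat.add_sub_cancel' hi.le, ha.period]

lemma findLeftmost_terminates (ha : IsTraversal H fwd a) (hk : 3 ≤ k) (s : WorkSpace k 6 3) :
    Terminates H findLeftmost s (12 * k + 11) fun o s' =>
      o = [] ∧ s'.ptr 0 = a 0 ∧ IsProbed H s' := by
  have htest : ∀ s : WorkSpace k 6 3, IsProbed H s →
      ((Test.not (.and (.coordLT 0 1) (.coordLT 0 2)) : Test 6 3).Holds H s ↔ s.ptr 0 ≠ a 0) := by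
    intro s hs
    simp only [Test.Holds, hs.self, hs.next, hs.prev]
    exact not_congr (ha.isLeftmost_iff hk _)
  let Inv : ℕ → List (Fin k × Fin k × Fin k) → WorkSpace k 6 3 → Prop := fun d o s =>
    o = [] ∧ IsProbed H s ∧ (finRotate k)^[d] (s.ptr 0) = a 0
  have hloop := Terminates.while (H := H) (b := .not (.and (.coordLT 0 1) (.coordLT 0 2)))
    (S := .seq (.next 0) probe) (N := 8) Inv (by
    rintro d o s ⟨rfl, h1, h2⟩ hb
    rw [htest s h1] at hb
    obtain ⟨d, rfl⟩ : ∃ d', d = d' + 1 := by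
      refine ⟨d - 1, ?_⟩
      rcases Nat.eq_zero_or_pos d with rfl | h
      · exact absurd h2 hb
      · omega
    refine ⟨d, rfl, Terminates.seq (N := 1) (N' := 7) (Terminates.stepPtr (fwd := true) ?_)⟩
    refine (probe_terminates _).mono le_rfl ?_
    rintro _ s' ⟨rfl, h3, h4⟩
    refine ⟨rfl, h4, ?_⟩
    rw [h3]
    simpa [stepPerm] using h2)
  obtain ⟨d, hd, hda⟩ := ha.exists_iterate (s.ptr 0)
  refine Terminates.mono (N := 7 + (d * (4 + 8) + 4)) (Terminates.seq
    ((probe_terminates s).mono le_rfl ?_)) (by omega) fun _ _ h => h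
  rintro _ s1 ⟨rfl, h1, h2⟩
  refine (hloop d [] s1 ⟨rfl, h2, by rw [h1, hda]⟩).mono le_rfl ?_
  rintro o s' ⟨⟨d', h3, h4, -⟩, hb⟩
  rw [htest s' h4, not_not] at hb
  exact ⟨by simpa using h3, hb, h4⟩

lemma triangulateMountain_terminates (hM : IsMountain H) (hg : InGeneralPosition H)
    (s : WorkSpace k 6 3) :
    Terminates H triangulateMountain s (44 * k ^ 2) fun o _ => OutputsTriangulation H o := by
  obtain ⟨fwd, a, ha⟩ := hM.exists_traversal
  have hk := hM.1.three_le
  refine Terminates.mono (N := (12 * k + 11) + (1 + (k * (9 * k + 13) + 7))) ?_ (by nlinarith)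
    fun _ _ h => h
  refine Terminates.seq ((findLeftmost_terminates ha hk s).mono le_rfl ?_)
  rintro _ s' ⟨rfl, h1, h2⟩
  simp only [List.nil_append]
  have hlt := ha.lt 1 (k - 1) (by omega) (by omega)
  have e0 : stepPerm k fwd (a 0) = a 1 := (ha.succ 0).symm
  have e1 := ha.pred_zero (by omega)
  -- the neighbour of the leftmost vertex on the chain is to the left of the one on the base
  have hdir : (Test.coordLT 1 2 : Test 6 3).Holds H s' ↔ fwd = true := by
    simp only [Test.Holds, h2.next, h2.prev, h1]
    cases fwd
    · change H (stepPerm k (!false) (a 0)) 0 < H (stepPerm k false (a 0)) 0 ↔ _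
      rw [e0, e1]
      simpa using hlt.le
    · change H (stepPerm k true (a 0)) 0 < H (stepPerm k (!true) (a 0)) 0 ↔ _
      rw [e0, e1]
      simpa using hlt
  refine Terminates.ite (fun hb => ?_) fun hb => ?_
  · obtain rfl := hdir.1 hb
    exact triangulateFrom_terminates ha hM.1 hg h1
  · obtain rfl : fwd = false := by simpa using mt hdir.2 hb
    exact triangulateFrom_terminates ha hM.1 hg h1

end Correctness

theorem mainTheorem2 :
    ∃ (m n : ℕ) (S : Program m n) (C : ℕ),
      ∀ (k : ℕ) (H : Polygon Plane k), IsMountain H → InGeneralPosition H →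
        ∀ s : WorkSpace k m n,
          ∃ (t : ℕ) (out : List (Fin k × Fin k × Fin k)) (s' : WorkSpace k m n),
            Runs H S s t out s' ∧ t ≤ C * k ^ 2 ∧ OutputsTriangulation H out :=
  ⟨6, 3, triangulateMountain, 44, fun _ _ hM hg s => triangulateMountain_terminates hM hg s⟩
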